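/- Let $\Delta$ be an irreducible reduced crystallographic root system (the root system of a simple Lie algebra) in a rational vector space $V$, with Weyl group $W$, a $W$-invariant inner product $(\ ,\ )$, simple roots $\Pi$, positive roots $\Delta^+$ and highest root $\theta$. A root is long if it has maximal length. An Abelian ideal is a set $I\subset\Delta^+$ such that $\gamma+\nu\notin\Delta$ for all $\gamma,\nu\in I$, and $\gamma+\nu\in I$ whenever $\gamma\in I$, $\nu\in\Delta^+$ and $\gamma+\nu\in\Delta$. Extend $(\ ,\ )$ to $\widehat V=V\oplus\mathbb Q\delta\oplus\mathbb Q\lambda$ so that $\delta,\lambda$ are isotropic and orthogonal to $V$ and $(\delta,\lambda)=1$. Put $\alpha_0=\delta-\theta$, let $\widehat W$ be the group generated by the reflections of $\widehat V$ in $\Pi\cup\{\alpha_0\}$, and let $\widehat\Delta^+=\Delta^+\cup\{\alpha+k\delta\mid\alpha\in\Delta,\ k\ge 1\}$. To each Abelian ideal $I$ there corresponds a unique (minuscule) element $w\in\widehat W$ with $\{a\in\widehat\Delta^+\mid w(a)\in-\widehat\Delta^+\}=\{\delta-\gamma\mid\gamma\in I\}$; for $I\ne\varnothing$, the rootlet of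 $I$ is $w(\alpha_0)+\delta$, which is a long positive root. For a long positive root $\mu$, let $\mathrm{Ab}_\mu$ be the set of nonempty Abelian ideals with rootlet $\mu$, ordered by inclusion. Proposition. Let $\mu$ be a long positive root with $(\mu,\theta)=0$. Then $$\#\mathrm{Ab}_\mu>2\iff\text{there is }\alpha_i\in\Pi\text{ with }(\alpha_i,\theta)>0\text{ and }(\alpha_i,\mu)=0 .$$ Moreover, $\mathrm{Ab}_\mu$ has a least element $I(\mu)_{min}$, there is a unique element $w_\mu\in W$ of minimal length (with respect to the simple reflections) among the elements of $W$ taking $\theta$ to $\mu$, the set $\mathrm{Ab}_\mu\setminus\{I(\mu)_{min}\}$ has the least element $I'=I(\mu)_{min}\cup\{w_\mu^{-1}(\theta)\}$, and the next ideals of $\mathrm{Ab}_\mu$, i.e. the minimal elements of $\mathrm{Ab}_\mu\setminus\{I(\mu)_{min},I'\}$, are exactly the ideals $$I(\mu)_{min}\cup\{w_\mu^{-1}(\theta),\,w_\mu^{-1}(\theta-\alpha_i)\},\qquad \alpha_i\in\Pi,\ (\alpha_i,\theta)>0,\ (\alpha_i,\mu)=0 .$$ -/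

import Mathlib

noncomputable section

namespace AbelianIdeals

open RootPairing

variable {ι M N : Type*} [AddCommGroup M] [Module ℚ M] [AddCommGroup N] [Module ℚ N]
  {P : RootPairing ι ℚ M N}

/-! ### Finite root data -/

/-- The set `Δ` of roots, as vectors. -/
def roots (P : RootPairing ι ℚ M N) : Set M := Set.range P.root

/-- The set `Δ⁺` of positive roots with respect to the base `b`. -/
def posRoots (b : P.Base) : Set M := P.root '' {i | b.IsPos i}

/-- The set `Π` of simple roots. -/
def simpleRoots (b : P.Base) : Set M := P.root '' (b.support : Set ι)

/-- `θ` is the highest root: a root such that `θ - β` is a sum of simple roots for every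
root `β`. -/
def IsHighestRoot (b : P.Base) (θ : M) : Prop :=
  θ ∈ roots P ∧ ∀ β ∈ roots P, θ - β ∈ AddSubmonoid.closure (simpleRoots b)

/-- The set `Δ⁺_l` of long positive roots: the positive roots of maximal length for the inner
product `B`.  If all roots have the same length, all of them are long. -/
def longPosRoots (b : P.Base) (B : LinearMap.BilinForm ℚ M) : Set M :=
  {μ | μ ∈ posRoots b ∧ ∀ β ∈ roots P, B β β ≤ B μ μ}

/-- A (combinatorial) Abelian ideal: a set `I` of positive roots such that no sum of two members
is a root, and such that a root of the form `γ + ν` with `γ ∈ I`, `ν ∈ Δ⁺` is again in `I`. -/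
structure IsAbelianIdeal (b : P.Base) (I : Set M) : Prop where
  subset_posRoots : I ⊆ posRoots b
  add_notMem : ∀ γ ∈ I, ∀ ν ∈ I, γ + ν ∉ roots P
  add_mem : ∀ γ ∈ I, ∀ ν ∈ posRoots b, γ + ν ∈ roots P → γ + ν ∈ I

/-- The length of an element of the Weyl group with respect to the simple reflections. -/
def weylLength (b : P.Base) (w : P.weylGroup) : ℕ :=
  sInf {n | ∃ l : List ι, l.length = n ∧ (∀ i ∈ l, i ∈ b.support) ∧
    w = (l.map (weylGroup.ofIdx P)).prod}

/-- `w` is an element of minimal length among the elements of the Weyl group taking `θ` to `μ`. -/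
def IsShortestTo (b : P.Base) (θ μ : M) (w : P.weylGroup) : Prop :=
  w • θ = μ ∧ ∀ u : P.weylGroup, u • θ = μ → weylLength b w ≤ weylLength b u

/-! ### Affine root data

The space `V ⊕ ℚδ ⊕ ℚλ` is `M × ℚ × ℚ`; a vector `v + xδ + yλ` is the triple `(v, x, y)`. -/

/-- The vector `δ`. -/
def delta : M × ℚ × ℚ := (0, 1, 0)

/-- The inclusion of `V`. -/
def incl (v : M) : M × ℚ × ℚ := (v, 0, 0)

/-- The extension of the inner product to `V ⊕ ℚδ ⊕ ℚλ`: `δ` and `λ` are isotropic and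
orthogonal to `V`, and `(δ, λ) = 1`. -/
def affineForm (B : LinearMap.BilinForm ℚ M) (x y : M × ℚ × ℚ) : ℚ :=
  B x.1 y.1 + x.2.1 * y.2.2 + x.2.2 * y.2.1

/-- The positive affine (real) roots: `Δ⁺ ∪ {α + kδ | α ∈ Δ, k ≥ 1}`. -/
def affinePosRoots (b : P.Base) : Set (M × ℚ × ℚ) :=
  incl '' posRoots b ∪ {x | ∃ α ∈ roots P, ∃ k : ℕ, 1 ≤ k ∧ x = incl α + (k : ℚ) • delta}

/-- The affine simple root `α₀ = δ - θ`. -/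
def alphaZero (θ : M) : M × ℚ × ℚ := delta - incl θ

/-- The affine simple roots `Π ∪ {α₀}`. -/
def affineSimpleRoots (b : P.Base) (θ : M) : Set (M × ℚ × ℚ) :=
  insert (alphaZero θ) (incl '' simpleRoots b)

/-- `s` is the reflection `x ↦ x - (2 (x, a) / (a, a)) a` in the vector `a`. -/
def IsReflectionIn (B : LinearMap.BilinForm ℚ M) (a : M × ℚ × ℚ)
    (s : (M × ℚ × ℚ) ≃ₗ[ℚ] (M × ℚ × ℚ)) : Prop :=
  ∀ x, s x = x - (2 * affineForm B x a / affineForm B a a) • a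

/-- The affine Weyl group, generated by the reflections in the affine simple roots. -/
def affineWeylGroup (b : P.Base) (B : LinearMap.BilinForm ℚ M) (θ : M) :
    Subgroup ((M × ℚ × ℚ) ≃ₗ[ℚ] (M × ℚ × ℚ)) :=
  Subgroup.closure {s | ∃ a ∈ affineSimpleRoots b θ, IsReflectionIn B a s}

/-- The set `N̂(w)` of positive affine roots made negative by `w`. -/
def inversions (b : P.Base) (w : (M × ℚ × ℚ) ≃ₗ[ℚ] (M × ℚ × ℚ)) : Set (M × ℚ × ℚ) :=
  {a | a ∈ affinePosRoots b ∧ -(w a) ∈ affinePosRoots b}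

/-- `w` is the minuscule element of the affine Weyl group that corresponds to the set `I` of
positive roots: `N̂(w) = {δ - γ | γ ∈ I}`. -/
def IsMinusculeFor (b : P.Base) (B : LinearMap.BilinForm ℚ M) (θ : M) (I : Set M)
    (w : (M × ℚ × ℚ) ≃ₗ[ℚ] (M × ℚ × ℚ)) : Prop :=
  w ∈ affineWeylGroup b B θ ∧ inversions b w = (fun γ ↦ delta - incl γ) '' I

/-- `μ` is the rootlet of `I`: `μ = w(α₀) + δ`, where `w` is the minuscule element
corresponding to `I`. -/
def IsRootlet (b : P.Base) (B : LinearMap.BilinForm ℚ M) (θ : M) (I : Set M) (μ : M) : Prop :=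
  ∃ w, IsMinusculeFor b B θ I w ∧ w (alphaZero θ) + delta = incl μ

/-- The poset `Ab_μ` (ordered by inclusion) of the nontrivial Abelian ideals with rootlet `μ`. -/
def Ab (b : P.Base) (B : LinearMap.BilinForm ℚ M) (θ μ : M) : Set (Set M) :=
  {I | IsAbelianIdeal b I ∧ I.Nonempty ∧ IsRootlet b B θ I μ}

end AbelianIdeals

end

/-! An ideal with rootlet `μ` splits into the members that pair positively with `θ` and those
orthogonal to `θ`.

The first half depends only on `μ` (`mem_iff_mem_minIdeal`). Let `w` be the minuscule element and
`s₀` the reflection in `α₀`, so that `w s₀ θ = μ`. Factor `w s₀ = x u` with `u` in the finite Weyl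
group and `x` positive on `Δ⁺`. All inversions of `x` are orthogonal to `uθ`, hence `x` fixes `uθ`,
and `uθ = μ`. Moreover `u` keeps the simple roots orthogonal to `θ` positive, which identifies it
with the shortest element `w_μ`. For `γ ≠ θ` with `(γ, θ) > 0` this gives `w(δ - γ) = x w_μ(θ - γ)`,
whose sign is that of `w_μ(θ - γ)`. The element `w_μ s₀` produces an ideal consisting of this half
alone (`hasRootlet_minIdeal`), so that ideal is the least one.

Transported by `w_μ`, the second half is a set of positive roots `β` orthogonal to `μ`. For a
positive root `κ` not orthogonal to `μ`, `κ + β` is never a root (`add_notMem_of_form_ne_zero`). So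
a step `β + α` in the root order uses a simple `α` orthogonal to `μ`, and it stays in the half.
Every positive root other than `θ` admits such a step, so a nonempty half contains `θ`, and a half
with a further member contains some `θ - α` (`theta_mem_orthogonalPart`).

Conversely, multiplying `w_μ s₀` on the left by `s₀` and then by `s_α` adds `w_μ⁻¹ θ` and `w_μ⁻¹(θ -
α)`; the rootlet survives because `μ` is orthogonal to `α₀` and to `α`. The Abelian property follows
from the behaviour of inversions under sums (`isAbelianIdeal_of_inversions`). -/

/-! ### Groups generated by simple reflections -/

/-- Elements `s i` (`i ∈ S`) of a group acting on `E` behave like the simple reflections of a root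
system with simple roots `a i` and set of positive roots `pos`. -/
structure IsSimpleSystem {G E σ : Type*} [Group G] [AddGroup E] [DistribMulAction G E]
    (pos : Set E) (S : Set σ) (a : σ → E) (s : σ → G) : Prop where
  mem_pos : ∀ i ∈ S, a i ∈ pos
  neg_notMem : ∀ x ∈ pos, -x ∉ pos
  mul_self : ∀ i ∈ S, s i * s i = 1
  smul_self : ∀ i ∈ S, s i • a i = -a i
  smul_pos : ∀ i ∈ S, ∀ x ∈ pos, x ≠ a i → s i • x ∈ pos
  -- Only products of simple reflections are considered: in the affine case `G` is the group of all
  -- linear automorphisms, which need not preserve the form.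
  conj : ∀ i ∈ S, ∀ j ∈ S, ∀ l : List σ, (∀ k ∈ l, k ∈ S) →
    (l.map s).prod • a i = a j → (l.map s).prod * s i = s j * (l.map s).prod

namespace IsSimpleSystem

variable {G E σ : Type*} [Group G] [AddGroup E] [DistribMulAction G E]
  {pos : Set E} {S : Set σ} {a : σ → E} {s : σ → G}

theorem pos_or_neg (h : IsSimpleSystem pos S a s) {l : List σ} (hl : ∀ k ∈ l, k ∈ S) {x : E}
    (hx : x ∈ pos) : (l.map s).prod • x ∈ pos ∨ -((l.map s).prod • x) ∈ pos := by
  induction l with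
  | nil => simpa using Or.inl hx
  | cons j l ih =>
    have hj : j ∈ S := hl j (by simp)
    have key : ∀ y ∈ pos, s j • y ∈ pos ∨ -(s j • y) ∈ pos := by
      intro y hy
      by_cases hya : y = a j
      · right; rw [hya, h.smul_self j hj, neg_neg]; exact h.mem_pos j hj
      · exact Or.inl (h.smul_pos j hj y hy hya)
    rw [List.map_cons, List.prod_cons, mul_smul]
    rcases ih (fun k hk ↦ hl k (by simp [hk])) with h1 | h1
    · exact key _ h1
    · have := key _ h1
      rw [smul_neg, neg_neg] at this
      exact this.symm

/-- The exchange property. -/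
theorem exchange (h : IsSimpleSystem pos S a s) {l : List σ} (hl : ∀ k ∈ l, k ∈ S) {i : σ}
    (hi : i ∈ S) (hneg : -((l.map s).prod • a i) ∈ pos) :
    ∃ l' : List σ, (∀ k ∈ l', k ∈ S) ∧ l'.length + 1 = l.length ∧
      (l.map s).prod = (l'.map s).prod * s i := by
  induction l with
  | nil => exact absurd (by simpa using hneg) (h.neg_notMem _ (h.mem_pos i hi))
  | cons j l ih =>
    have hj : j ∈ S := hl j (by simp)
    have hl0 : ∀ k ∈ l, k ∈ S := fun k hk ↦ hl k (by simp [hk])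
    -- If the tail keeps `a i` positive, the sign changes at `s j`, so the tail takes `a i` to `a j`
    -- and `conj` trades the leading `s j` for a final `s i`. Otherwise the tail already satisfies
    -- the hypothesis.
    rcases h.pos_or_neg hl0 (h.mem_pos i hi) with h1 | h1
    · have hja : (l.map s).prod • a i = a j := by
        by_contra hne
        rw [List.map_cons, List.prod_cons, mul_smul] at hneg
        exact h.neg_notMem _ (h.smul_pos j hj _ h1 hne) hneg
      exact ⟨l, hl0, rfl, by rw [List.map_cons, List.prod_cons, h.conj i hi j hj l hl0 hja]⟩
    · obtain ⟨l', hl', hlen, hprod⟩ := ih hl0 h1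
      refine ⟨j :: l', ?_, by simp [hlen], by simp [hprod, mul_assoc]⟩
      simpa [hj] using hl'

/-- If the word ends in `s i`, the preceding part makes `a i` negative, so exchange lets this final
`s i` cancel against another letter; the word becomes two letters shorter. -/
theorem prod_eq_one (h : IsSimpleSystem pos S a s) {l : List σ} (hl : ∀ k ∈ l, k ∈ S)
    (hpos : ∀ i ∈ S, (l.map s).prod • a i ∈ pos) : (l.map s).prod = 1 := by
  generalize hn : l.length = n
  induction n using Nat.strong_induction_on generalizing l with
  | _ n ih =>
    rcases List.eq_nil_or_concat l with rfl | ⟨l0, i, rfl⟩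
    · simp
    · have hi : i ∈ S := hl i (by simp)
      have hl0 : ∀ k ∈ l0, k ∈ S := fun k hk ↦ hl k (by simp [hk])
      have hp := hpos i hi
      rw [List.concat_eq_append, List.map_append, List.prod_append, List.map_singleton,
        List.prod_singleton, mul_smul, h.smul_self i hi, smul_neg] at hp
      obtain ⟨l', hl', hlen, hprod⟩ := h.exchange hl0 hi hp
      have heq : ((l0.concat i).map s).prod = (l'.map s).prod := by
        simp [hprod, mul_assoc, h.mul_self i hi]
      rw [heq] at hpos ⊢
      refine ih l'.length ?_ hl' hpos rfl
      simp only [List.concat_eq_append, List.length_append, List.length_singleton] at hn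
      omega

theorem inv_prod (h : IsSimpleSystem pos S a s) {l : List σ} (hl : ∀ k ∈ l, k ∈ S) :
    ((l.map s).prod)⁻¹ = (l.reverse.map s).prod := by
  rw [List.prod_inv_reverse, List.map_reverse, List.map_map]
  congr 2
  refine List.map_congr_left fun k hk ↦ ?_
  simpa using inv_eq_of_mul_eq_one_left (h.mul_self k (hl k hk))

/-- Multiplying by a simple reflection adds one inversion. -/
theorem inversions_mul (h : IsSimpleSystem pos S a s) {i : σ} (hi : i ∈ S) {g : G} {x : E}
    (hx : x ∈ pos) (hgx : g • x = a i) :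
    {y | y ∈ pos ∧ -((s i * g) • y) ∈ pos} = insert x {y | y ∈ pos ∧ -(g • y) ∈ pos} := by
  ext y
  simp only [Set.mem_ofPred_eq, Set.mem_insert_iff, mul_smul]
  constructor
  · rintro ⟨hy, hneg⟩
    by_cases hyx : y = x
    · exact Or.inl hyx
    · refine Or.inr ⟨hy, ?_⟩
      rw [← smul_neg] at hneg
      by_cases hne : s i • -(g • y) = a i
      · exfalso
        have h1 : -(g • y) = s i • a i := by rw [← hne, smul_smul, h.mul_self i hi, one_smul]
        rw [h.smul_self i hi, neg_inj, ← hgx] at h1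
        exact hyx (MulAction.injective g h1)
      · have := h.smul_pos i hi _ hneg hne
        rwa [smul_smul, h.mul_self i hi, one_smul] at this
  · rintro (rfl | ⟨hy, hneg⟩)
    · exact ⟨hx, by rw [hgx, h.smul_self i hi, neg_neg]; exact h.mem_pos i hi⟩
    · refine ⟨hy, ?_⟩
      rw [← smul_neg]
      refine h.smul_pos i hi _ hneg fun hne ↦ ?_
      have : g • (-x) = g • y := by rw [smul_neg, hgx, ← hne, neg_neg]
      have := MulAction.injective g this
      exact h.neg_notMem _ hx (this ▸ hy)

end IsSimpleSystem

open RootPairing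

noncomputable section

namespace AbelianIdeals

/-! ### Finite root system: heights, the highest root, and the root order. -/

section Roots

variable {ι M N : Type*} [AddCommGroup M] [Module ℚ M] [AddCommGroup N] [Module ℚ N]
  {P : RootPairing ι ℚ M N}

theorem exists_height_functional [Finite ι] [Nonempty ι] [P.IsIrreducible] (b : P.Base) :
    ∃ h : M →ₗ[ℚ] ℚ, ∀ i, h (P.root i) = b.height i := by
  -- The simple roots form a basis, and the functional is 1 on each of them.
  refine ⟨b.toWeightBasis.constr ℚ fun _ ↦ 1, fun i ↦ ?_⟩
  obtain ⟨f, -, -, hf⟩ := b.exists_root_eq_sum_int i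
  rw [Base.height_eq_sum hf, hf, map_sum, Int.cast_sum]
  refine Finset.sum_congr rfl fun j hj ↦ ?_
  have := b.toWeightBasis.constr_basis ℚ (fun _ ↦ (1 : ℚ)) ⟨j, hj⟩
  rw [Base.toWeightBasis_apply] at this
  rw [map_zsmul, this]
  simp

/-- A positive definite invariant form `B`, the highest root `θ` and the height function `h`. -/
structure Setting (b : P.Base) (B : P.InvariantForm) (θ : M) (h : M →ₗ[ℚ] ℚ) : Prop where
  pos_def : ∀ x : M, x ≠ 0 → 0 < B.form x x
  highest : IsHighestRoot b θ
  height : ∀ i, h (P.root i) = b.height i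

namespace Setting

variable {b : P.Base} {B : P.InvariantForm} {θ : M} {h : M →ₗ[ℚ] ℚ}

theorem symm (_H : Setting b B θ h) (x y : M) : B.form x y = B.form y x := by
  simpa using B.symm.eq x y

theorem zero_notMem (_H : Setting b B θ h) : (0 : M) ∉ roots P := by
  rintro ⟨i, hi⟩
  exact P.ne_zero i hi

theorem self_pos (H : Setting b B θ h) {x : M} (hx : x ∈ roots P) : 0 < B.form x x :=
  H.pos_def x fun h0 ↦ H.zero_notMem (h0 ▸ hx)

theorem neg_mem (_H : Setting b B θ h) {x : M} (hx : x ∈ roots P) : -x ∈ roots P := by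
  obtain ⟨i, rfl⟩ := hx
  exact P.neg_root_mem i

theorem theta_mem (H : Setting b B θ h) : θ ∈ roots P := H.highest.1

theorem mem_posRoots (H : Setting b B θ h) {x : M} : x ∈ posRoots b ↔ x ∈ roots P ∧ 0 < h x := by
  constructor
  · rintro ⟨i, hi, rfl⟩
    exact ⟨⟨i, rfl⟩, by rw [H.height]; exact_mod_cast hi⟩
  · rintro ⟨⟨i, rfl⟩, hi⟩
    exact ⟨i, by rw [H.height] at hi; exact_mod_cast hi, rfl⟩

theorem exists_height_eq (H : Setting b B θ h) {x : M} (hx : x ∈ roots P) :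
    ∃ n : ℤ, h x = n ∧ n ≠ 0 := by
  obtain ⟨i, rfl⟩ := hx
  exact ⟨_, H.height i, b.height_ne_zero i⟩

theorem pos_or_neg (H : Setting b B θ h) {x : M} (hx : x ∈ roots P) :
    x ∈ posRoots b ∨ -x ∈ posRoots b := by
  obtain ⟨n, hn, h0⟩ := H.exists_height_eq hx
  rcases lt_or_gt_of_ne h0 with h1 | h1
  · refine Or.inr (H.mem_posRoots.2 ⟨H.neg_mem hx, ?_⟩)
    rw [map_neg, hn]
    exact_mod_cast neg_pos.2 h1
  · exact Or.inl (H.mem_posRoots.2 ⟨hx, by rw [hn]; exact_mod_cast h1⟩)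

theorem one_le_height (H : Setting b B θ h) {x : M} (hx : x ∈ posRoots b) : 1 ≤ h x := by
  obtain ⟨hx, h0⟩ := H.mem_posRoots.1 hx
  obtain ⟨n, hn, -⟩ := H.exists_height_eq hx
  rw [hn] at h0 ⊢
  exact_mod_cast h0

theorem root_of_pos (H : Setting b B θ h) {x : M} (hx : x ∈ posRoots b) : x ∈ roots P :=
  (H.mem_posRoots.1 hx).1

theorem neg_notMem (H : Setting b B θ h) {x : M} (hx : x ∈ posRoots b) : -x ∉ posRoots b := by
  intro h1
  have h2 := H.one_le_height hx
  have h3 := H.one_le_height h1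
  rw [map_neg] at h3
  linarith

theorem add_pos (H : Setting b B θ h) {x y : M} (hx : x ∈ posRoots b) (hy : y ∈ posRoots b)
    (hxy : x + y ∈ roots P) : x + y ∈ posRoots b := by
  refine H.mem_posRoots.2 ⟨hxy, ?_⟩
  rw [map_add]
  linarith [H.one_le_height hx, H.one_le_height hy]

theorem simple_mem (H : Setting b B θ h) {x : M} (hx : x ∈ simpleRoots b) :
    x ∈ posRoots b ∧ h x = 1 := by
  obtain ⟨i, hi, rfl⟩ := hx
  exact ⟨⟨i, b.isPos_of_mem_support hi, rfl⟩, by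
    rw [H.height, b.height_one_of_mem_support hi, Int.cast_one]⟩

theorem closure_height (H : Setting b B θ h) {x : M}
    (hx : x ∈ AddSubmonoid.closure (simpleRoots b)) : ∃ n : ℕ, h x = n ∧ (n = 0 → x = 0) := by
  induction hx using AddSubmonoid.closure_induction with
  | mem x hx => exact ⟨1, by simp [(H.simple_mem hx).2], by simp⟩
  | zero => exact ⟨0, by simp, fun _ ↦ rfl⟩
  | add x y _ _ ihx ihy =>
    obtain ⟨n, hn, hn0⟩ := ihx
    obtain ⟨m, hm, hm0⟩ := ihy
    refine ⟨n + m, by simp [hn, hm], fun h0 ↦ ?_⟩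
    rw [hn0 (by omega), hm0 (by omega), add_zero]

theorem height_le (H : Setting b B θ h) {x : M} (hx : x ∈ roots P) :
    h x ≤ h θ ∧ (h θ ≤ h x → x = θ) := by
  obtain ⟨n, hn, hn0⟩ := H.closure_height (H.highest.2 x hx)
  rw [map_sub] at hn
  constructor
  · linarith [n.cast_nonneg (α := ℚ)]
  · intro hle
    refine (sub_eq_zero.1 (hn0 ?_)).symm
    have : (n : ℚ) ≤ 0 := by linarith
    exact_mod_cast le_antisymm this n.cast_nonneg

theorem theta_pos (H : Setting b B θ h) : θ ∈ posRoots b := by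
  refine (H.pos_or_neg H.theta_mem).resolve_right fun hneg ↦ ?_
  have h1 := H.one_le_height hneg
  have h2 := (H.height_le (H.root_of_pos hneg)).1
  rw [map_neg] at h1 h2
  linarith

theorem theta_add_notMem (H : Setting b B θ h) {x : M} (hx : x ∈ posRoots b) :
    θ + x ∉ roots P := by
  intro hm
  have := (H.height_le hm).1
  rw [map_add] at this
  linarith [H.one_le_height hx]

theorem exists_pairing [P.IsCrystallographic] (_H : Setting b B θ h) {x a : M}
    (hx : x ∈ roots P) (ha : a ∈ roots P) :
    ∃ n : ℤ, 2 * B.form x a = n * B.form a a ∧ x - (n : ℚ) • a ∈ roots P := by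
  obtain ⟨i, rfl⟩ := hx
  obtain ⟨j, rfl⟩ := ha
  refine ⟨P.pairingIn ℤ i j, ?_, P.reflectionPerm j i, ?_⟩
  · rw [B.two_mul_apply_root_root, ← P.algebraMap_pairingIn ℤ]; rfl
  · rw [root_reflectionPerm, reflection_apply_root, ← P.algebraMap_pairingIn ℤ]; rfl

theorem exists_sum_of_pos (_H : Setting b B θ h) {x : M} (hx : x ∈ posRoots b) :
    ∃ f : ι → ℤ, 0 ≤ f ∧ x = ∑ j ∈ b.support, f j • P.root j := by
  obtain ⟨i, hi, rfl⟩ := hx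
  obtain ⟨f, -, hf | hf, hsum⟩ := b.exists_root_eq_sum_int i
  · exact ⟨f, hf.le, hsum⟩
  · exfalso
    rw [Set.mem_ofPred_eq, Base.isPos_iff, Base.height_eq_sum hsum] at hi
    exact absurd hi (not_lt.2 (Finset.sum_nonpos fun j _ ↦ hf.le j))

variable [Finite ι] [P.IsCrystallographic]

theorem sub_mem (H : Setting b B θ h) {x y : M} (hx : x ∈ roots P) (hy : y ∈ roots P)
    (hxy : 0 < B.form x y) (hne : x ≠ y) : x - y ∈ roots P := by
  have hyy := H.self_pos hy
  obtain ⟨i, rfl⟩ := hx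
  obtain ⟨j, rfl⟩ := hy
  refine P.root_sub_root_mem_of_pairingIn_pos ?_ fun hij ↦ hne (by rw [hij])
  have h1 := B.two_mul_apply_root_root i j
  rw [← P.algebraMap_pairingIn ℤ] at h1
  have h2 : 0 < ((P.pairingIn ℤ i j : ℤ) : ℚ) * B.form (P.root j) (P.root j) := by
    rw [show ((P.pairingIn ℤ i j : ℤ) : ℚ) = algebraMap ℤ ℚ (P.pairingIn ℤ i j) from rfl, ← h1]
    linarith
  exact_mod_cast (pos_iff_pos_of_mul_pos h2).2 hyy

theorem add_mem (H : Setting b B θ h) {x y : M} (hx : x ∈ roots P) (hy : y ∈ roots P)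
    (hxy : B.form x y < 0) (hne : x ≠ -y) : x + y ∈ roots P := by
  have := H.sub_mem hx (H.neg_mem hy) (by rw [map_neg]; linarith) hne
  rwa [sub_neg_eq_add] at this

/-- If `x + (y + z)` is a root, then so is `x + y` or `x + z`. -/
theorem add_mem_or (H : Setting b B θ h) {x y z : M} (hx : x ∈ roots P) (hy : y ∈ roots P)
    (hz : z ∈ roots P) (hyz : y + z ∈ roots P) (hxyz : x + (y + z) ∈ roots P)
    (h1 : x ≠ -y) (h2 : x ≠ -z) : x + y ∈ roots P ∨ x + z ∈ roots P := by
  by_contra! hcon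
  obtain ⟨hxy, hxz⟩ := hcon
  -- If neither sum is a root, then `(x, y)`, `(x, z) ≥ 0`, while `x + y + z` pairs nonpositively
  -- with `y` and with `z`. Adding these up gives `(y + z, y + z) ≤ 0`.
  have a1 : 0 ≤ B.form x y := by
    by_contra! hc
    exact hxy (H.add_mem hx hy hc h1)
  have a2 : 0 ≤ B.form x z := by
    by_contra! hc
    exact hxz (H.add_mem hx hz hc h2)
  have a3 : B.form (x + (y + z)) y ≤ 0 := by
    by_contra! hc
    have := H.sub_mem hxyz hy hc fun he ↦ h2 (by
      have : x + z + y = 0 + y := by rw [zero_add]; nth_rw 2 [← he]; abel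
      exact eq_neg_of_add_eq_zero_left (add_right_cancel this))
    rw [show x + (y + z) - y = x + z by abel] at this
    exact hxz this
  have a4 : B.form (x + (y + z)) z ≤ 0 := by
    by_contra! hc
    have := H.sub_mem hxyz hz hc fun he ↦ h1 (by
      have : x + y + z = 0 + z := by rw [zero_add]; nth_rw 2 [← he]; abel
      exact eq_neg_of_add_eq_zero_left (add_right_cancel this))
    rw [show x + (y + z) - z = x + y by abel] at this
    exact hxy this
  have a5 := H.self_pos hyz
  simp only [map_add, LinearMap.add_apply] at a3 a4 a5
  linarith

theorem exists_simple_sub (_H : Setting b B θ h) {x : M} (hx : x ∈ posRoots b)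
    (hxs : x ∉ simpleRoots b) : ∃ a ∈ simpleRoots b, x - a ∈ posRoots b := by
  obtain ⟨i, hi, rfl⟩ := hx
  obtain ⟨j, hj, hji⟩ := Base.IsPos.exists_mem_support_pos_pairingIn hi
  have hij : i ≠ j := by rintro rfl; exact hxs ⟨i, hj, rfl⟩
  obtain ⟨k, hk⟩ := P.root_sub_root_mem_of_pairingIn_pos ((P.zero_lt_pairingIn_iff' ℤ).1 hji) hij
  exact ⟨P.root j, ⟨j, hj, rfl⟩, k, Base.IsPos.sub hi hj hk, hk⟩

/-- If `β + ρ` is a root for some positive root `ρ`, it is so for some simple root `ρ`. -/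
theorem exists_simple_add_of_add (H : Setting b B θ h) {β ρ : M} (hβ : β ∈ posRoots b)
    (hρ : ρ ∈ posRoots b) (hβρ : β + ρ ∈ roots P) : ∃ a ∈ simpleRoots b, β + a ∈ roots P := by
  obtain ⟨n, hn, -⟩ := H.exists_height_eq (H.root_of_pos hρ)
  have hn1 := H.one_le_height hρ
  rw [hn] at hn1
  obtain ⟨m, rfl⟩ := Int.eq_ofNat_of_zero_le (show 0 ≤ n by
    have : (1 : ℤ) ≤ n := by exact_mod_cast hn1
    omega)
  clear hn1
  -- Induction on the height of `ρ`: split off a simple root and let `add_mem_or` choose which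
  -- summand may be added to `β`.
  induction m using Nat.strong_induction_on generalizing ρ with
  | _ m ih =>
    by_cases hs : ρ ∈ simpleRoots b
    · exact ⟨ρ, hs, hβρ⟩
    · obtain ⟨a, ha, hρa⟩ := H.exists_simple_sub hρ hs
      have hap := (H.simple_mem ha).1
      have hne : ∀ y ∈ posRoots b, β ≠ -y := by
        rintro y hy rfl
        exact H.neg_notMem hy hβ
      have hsum : ρ - a + a = ρ := by abel
      rcases H.add_mem_or (H.root_of_pos hβ) (H.root_of_pos hρa) (H.root_of_pos hap)
        (by rw [hsum]; exact H.root_of_pos hρ) (by rw [hsum]; exact hβρ)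
        (hne _ hρa) (hne _ hap) with h1 | h1
      · have hh : h (ρ - a) = m - 1 := by
          rw [map_sub, hn, (H.simple_mem ha).2]; simp
        have h2 := H.one_le_height hρa
        have hm : 1 ≤ m := by
          rw [hh] at h2
          have : (1 : ℚ) ≤ m := by linarith
          exact_mod_cast this
        refine ih (m - 1) (by omega) hρa h1 ?_
        rw [hh]
        push_cast [hm]
        rfl
      · exact ⟨a, ha, h1⟩

theorem theta_nonneg (H : Setting b B θ h) {x : M} (hx : x ∈ posRoots b) : 0 ≤ B.form θ x := by
  by_contra! hc
  refine H.theta_add_notMem hx (H.add_mem H.theta_mem (H.root_of_pos hx) hc fun he ↦ ?_)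
  exact H.neg_notMem hx (he ▸ H.theta_pos)

theorem pos_of_theta (H : Setting b B θ h) {x : M} (hx : x ∈ roots P) (h1 : 0 < B.form θ x) :
    x ∈ posRoots b := by
  refine (H.pos_or_neg hx).resolve_right fun hn ↦ ?_
  have := H.theta_nonneg hn
  rw [map_neg] at this
  linarith

theorem simple_form_nonpos (H : Setting b B θ h) {i j : ι} (hi : i ∈ b.support)
    (hj : j ∈ b.support) (hij : i ≠ j) : B.form (P.root i) (P.root j) ≤ 0 := by
  by_contra! hc
  exact b.sub_notMem_range_root hi hj
    (H.sub_mem ⟨i, rfl⟩ ⟨j, rfl⟩ hc fun he ↦ hij (P.root.injective he))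

variable [P.IsReduced]

theorem reflection_pos (H : Setting b B θ h) {x a : M} (hx : x ∈ posRoots b)
    (ha : a ∈ simpleRoots b) (hxa : x ≠ a) {n : ℤ} (hn : 2 * B.form x a = n * B.form a a) :
    x - (n : ℚ) • a ∈ posRoots b := by
  have haa := H.self_pos (H.root_of_pos (H.simple_mem ha).1)
  obtain ⟨i, hi, rfl⟩ := hx
  obtain ⟨j, hj, rfl⟩ := ha
  refine ⟨P.reflectionPerm j i, Base.IsPos.reflectionPerm hi hj fun he ↦ hxa (by rw [he]), ?_⟩
  rw [root_reflectionPerm, reflection_apply_root]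
  rw [B.two_mul_apply_root_root] at hn
  rw [mul_right_cancel₀ haa.ne' hn]

variable [P.IsIrreducible]

/-- Suppose `(θ, β) = 0` and let `K` be the support of `β`. Then `θ` is orthogonal to the simple
roots in `K`. For a simple root outside `K`, dominance of `β` makes a sum of nonpositive terms
nonnegative, so that root is orthogonal to `K`. Hence the span of `K` is stable under the simple
reflections, so by irreducibility it is everything, and `θ` would be orthogonal to itself. -/
theorem theta_form_pos (H : Setting b B θ h) {β : M} (hβ : β ∈ posRoots b)
    (hdom : ∀ a ∈ simpleRoots b, 0 ≤ B.form β a) : 0 < B.form θ β := by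
  refine lt_of_le_of_ne (H.theta_nonneg hβ) fun h0 ↦ ?_
  obtain ⟨f, hf, hsum⟩ := H.exists_sum_of_pos hβ
  set K : Set ι := {i | i ∈ b.support ∧ f i ≠ 0}
  set q := Submodule.span ℚ (P.root '' K)
  have hθK : ∀ i ∈ K, B.form θ (P.root i) = 0 := by
    intro i hi
    have hnn : ∀ j ∈ b.support, 0 ≤ (f j : ℚ) * B.form θ (P.root j) := fun j hj ↦
      mul_nonneg (by exact_mod_cast hf j) (H.theta_nonneg (H.simple_mem ⟨j, hj, rfl⟩).1)
    have hs : ∑ j ∈ b.support, (f j : ℚ) * B.form θ (P.root j) = 0 := by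
      rw [h0, hsum, map_sum]
      exact Finset.sum_congr rfl fun j _ ↦ by rw [map_zsmul, zsmul_eq_mul]
    have := (Finset.sum_eq_zero_iff_of_nonneg hnn).1 hs i hi.1
    exact (mul_eq_zero.1 this).resolve_left (by exact_mod_cast hi.2)
  have hβq : β ∈ q := by
    rw [hsum]
    refine Submodule.sum_mem _ fun j hj ↦ ?_
    by_cases hj0 : f j = 0
    · simp [hj0]
    · rw [← Int.cast_smul_eq_zsmul ℚ]
      exact Submodule.smul_mem _ _ (Submodule.subset_span ⟨j, ⟨hj, hj0⟩, rfl⟩)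
  have hinv : ∀ j ∈ b.support, q ∈ Module.End.invtSubmodule (P.reflection j) := by
    intro j hj
    by_cases hjK : j ∈ K
    · exact Submodule.mem_invtSubmodule_reflection_of_mem _ _
        (Submodule.subset_span ⟨j, hjK, rfl⟩)
    · have horth : ∀ i ∈ K, B.form (P.root i) (P.root j) = 0 := by
        intro i hi
        have hnp : ∀ k ∈ b.support, (f k : ℚ) * B.form (P.root k) (P.root j) ≤ 0 := by
          intro k hk
          by_cases hkj : k = j
          · subst hkj
            have : f k = 0 := by
              by_contra hne
              exact hjK ⟨hk, hne⟩
            simp [this]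
          · exact mul_nonpos_of_nonneg_of_nonpos (by exact_mod_cast hf k)
              (H.simple_form_nonpos hk hj hkj)
        have hs : ∑ k ∈ b.support, (f k : ℚ) * B.form (P.root k) (P.root j) = 0 := by
          refine le_antisymm (Finset.sum_nonpos hnp) ?_
          have := hdom _ ⟨j, hj, rfl⟩
          rw [hsum, map_sum, LinearMap.sum_apply] at this
          refine this.trans_eq (Finset.sum_congr rfl fun k _ ↦ ?_)
          rw [map_zsmul, LinearMap.smul_apply, zsmul_eq_mul]
        have := (Finset.sum_eq_zero_iff_of_nonpos hnp).1 hs i hi.1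
        exact (mul_eq_zero.1 this).resolve_left (by exact_mod_cast hi.2)
      rw [Module.End.mem_invtSubmodule]
      refine Submodule.span_le.2 ?_
      rintro _ ⟨i, hi, rfl⟩
      have : P.pairing i j = 0 := B.apply_root_root_zero_iff i j |>.1 (horth i hi)
      simp only [Submodule.comap_coe, Set.mem_preimage, LinearEquiv.coe_coe, SetLike.mem_coe]
      rw [reflection_apply_root, this, zero_smul, sub_zero]
      exact Submodule.subset_span ⟨i, hi, rfl⟩
  have htop : q = ⊤ := by
    refine IsIrreducible.eq_top_of_invtSubmodule_reflection (P := P) q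
      ((b.forall_mem_support_invtSubmodule_iff q).1 hinv) fun hbot ↦ ?_
    rw [hbot, Submodule.mem_bot] at hβq
    exact H.zero_notMem (hβq ▸ H.root_of_pos hβ)
  have hker : q ≤ LinearMap.ker (B.form θ) := by
    refine Submodule.span_le.2 ?_
    rintro _ ⟨i, hi, rfl⟩
    exact hθK i hi
  have : B.form θ θ = 0 := hker (htop ▸ Submodule.mem_top)
  exact (H.self_pos H.theta_mem).ne' this

/-- Every positive root other than `θ` is covered by a root in the root order. -/
theorem exists_simple_add (H : Setting b B θ h) {β : M} (hβ : β ∈ posRoots b) (hne : β ≠ θ) :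
    ∃ a ∈ simpleRoots b, β + a ∈ roots P := by
  by_contra! hcon
  -- If no simple root can be added, `β` is dominant; then `θ - β` is a positive root that can be
  -- added to `β`, and it may be replaced by a simple one.
  have hdom : ∀ a ∈ simpleRoots b, 0 ≤ B.form β a := by
    intro a ha
    by_contra! hc
    refine hcon a ha (H.add_mem (H.root_of_pos hβ) (H.root_of_pos (H.simple_mem ha).1) hc ?_)
    rintro rfl
    exact H.neg_notMem (H.simple_mem ha).1 hβ
  have h1 := H.theta_form_pos hβ hdom
  have h2 := H.sub_mem H.theta_mem (H.root_of_pos hβ) h1 hne.symm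
  have h3 : θ - β ∈ posRoots b := by
    refine (H.pos_or_neg h2).resolve_right fun hn ↦ ?_
    have h4 := H.one_le_height hn
    have h5 := (H.height_le (H.root_of_pos hβ)).1
    rw [map_neg, map_sub] at h4
    linarith
  obtain ⟨a, ha, h4⟩ := H.exists_simple_add_of_add hβ h3 (by
    rw [add_sub_cancel]; exact H.theta_mem)
  exact hcon a ha h4

end Setting

end Roots

/-! ### Finite Weyl group: words, exchange, and shortest elements taking `θ` to `μ`. -/

section Weyl

variable {ι M N : Type*} [AddCommGroup M] [Module ℚ M] [AddCommGroup N] [Module ℚ N]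
  {P : RootPairing ι ℚ M N} {b : P.Base} {B : P.InvariantForm} {θ : M} {h : M →ₗ[ℚ] ℚ}

theorem weylGroup_ext {u v : P.weylGroup} (huv : ∀ x : M, u • x = v • x) : u = v := by
  refine Subtype.ext (Equiv.weightHom_injective P (LinearEquiv.ext fun x ↦ ?_))
  exact huv x

theorem ofIdx_smul_eq (i : ι) (x : M) :
    weylGroup.ofIdx P i • x = x - P.coroot' i x • P.root i := rfl

theorem ofIdx_mul_self (i : ι) : weylGroup.ofIdx P i * weylGroup.ofIdx P i = 1 := by
  refine weylGroup_ext fun x ↦ ?_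
  rw [mul_smul, one_smul]
  exact P.reflection_same i x

theorem ofIdx_reflectionPerm (i j : ι) : weylGroup.ofIdx P (P.reflectionPerm j i) =
    weylGroup.ofIdx P j * weylGroup.ofIdx P i * weylGroup.ofIdx P j := by
  refine weylGroup_ext fun x ↦ ?_
  exact LinearEquiv.congr_fun (P.reflection_reflectionPerm (i := i) (j := j)) x

theorem smul_mem_roots (u : P.weylGroup) {x : M} (hx : x ∈ roots P) : u • x ∈ roots P := by
  obtain ⟨i, rfl⟩ := hx
  rw [P.weylGroup_apply_root]
  exact ⟨_, rfl⟩

theorem weyl_smul_smul (u : P.weylGroup) (t : ℚ) (x : M) : u • (t • x) = t • (u • x) :=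
  smul_comm u t x

theorem two_mul_form_root (B : P.InvariantForm) (x : M) (i : ι) :
    2 * B.form x (P.root i) = P.coroot' i x * B.form (P.root i) (P.root i) := by
  have h1 := B.apply_reflection_reflection i x (P.root i)
  rw [reflection_apply_self, reflection_apply, map_neg, LinearMap.map_sub₂,
    LinearMap.map_smul₂, smul_eq_mul] at h1
  linarith

theorem weyl_form (B : P.InvariantForm) (u : P.weylGroup) (x y : M) :
    B.form (u • x) (u • y) = B.form x y := InvariantForm.apply_weylGroup_smul P u x y

theorem weyl_form_inv (B : P.InvariantForm) (u : P.weylGroup) (x y : M) :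
    B.form (u⁻¹ • x) y = B.form x (u • y) := by
  rw [← weyl_form B u, smul_inv_smul]

theorem Setting.exists_isShortestTo (_H : Setting b B θ h) {μ : M} (hex : ∃ u : P.weylGroup, u • θ = μ) :
    ∃ w : P.weylGroup, IsShortestTo b θ μ w := by
  obtain ⟨u, hu⟩ := hex
  obtain ⟨w, hw, hmin⟩ := (measure (weylLength b)).wf.has_min {u : P.weylGroup | u • θ = μ} ⟨u, hu⟩
  exact ⟨w, hw, fun v hv ↦ not_lt.1 (hmin v hv)⟩

/-- The long roots form one orbit of the Weyl group. -/
theorem Setting.exists_smul_theta_eq [Finite ι] (H : Setting b B θ h) {μ : M} (hμ : μ ∈ longPosRoots b B.form) :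
    ∃ u : P.weylGroup, u • θ = μ := by
  obtain ⟨hμ, hlong⟩ := hμ
  have hμr := H.root_of_pos hμ
  have hfin : (Set.range fun u : P.weylGroup ↦ u • μ).Finite :=
    (Set.finite_range P.root).subset (by rintro _ ⟨u, rfl⟩; exact smul_mem_roots u hμr)
  -- A member of the orbit of maximal height is dominant, since a simple reflection cannot raise it
  -- further.
  obtain ⟨_, ⟨u, rfl⟩, hmax⟩ := Set.exists_max_image _ h hfin ⟨_, 1, rfl⟩
  set ν := u • μ with hν
  have hνr : ν ∈ roots P := smul_mem_roots u hμr
  have hdom : ∀ a ∈ simpleRoots b, 0 ≤ B.form ν a := by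
    rintro _ ⟨i, hi, rfl⟩
    have h1 : h (weylGroup.ofIdx P i • ν) ≤ h ν :=
      hmax _ ⟨weylGroup.ofIdx P i * u, mul_smul _ _ _⟩
    have h2 := two_mul_form_root B ν i
    rw [ofIdx_smul_eq, h.map_sub, h.map_smul, (H.simple_mem ⟨i, hi, rfl⟩).2, smul_eq_mul] at h1
    have h3 := H.self_pos (x := P.root i) ⟨i, rfl⟩
    have h4 : 0 ≤ P.coroot' i ν := by linarith
    linarith [mul_nonneg h4 h3.le]
  have h1 : 0 ≤ B.form ν (θ - ν) := by
    have := H.highest.2 ν hνr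
    generalize θ - ν = x at this
    induction this using AddSubmonoid.closure_induction with
    | mem x hx => exact hdom x hx
    | zero => simp
    | add x y _ _ hx hy => rw [map_add]; exact add_nonneg hx hy
  have h2 : B.form θ θ ≤ B.form ν ν := by
    rw [hν, weyl_form]
    exact hlong θ H.theta_mem
  -- Here `|θ - ν|² = |θ|² - |ν|² - 2(ν, θ - ν) ≤ 0`, using `|θ| ≤ |ν|` and the dominance of `ν`.
  have h3 : θ - ν = 0 := by
    by_contra hne
    have h4 := H.pos_def _ hne
    have h5 := H.symm θ ν
    simp only [map_sub, LinearMap.sub_apply] at h1 h4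
    linarith
  exact ⟨u⁻¹, by rw [sub_eq_zero.1 h3, hν, inv_smul_smul]⟩

variable [Finite ι] [P.IsCrystallographic]

/-- A functional which is nonnegative on the simple roots orthogonal to `θ` is so on the positive
roots orthogonal to `θ`. -/
theorem Setting.functional_nonneg (H : Setting b B θ h) (f : M →ₗ[ℚ] ℚ)
    (hf : ∀ a ∈ simpleRoots b, B.form θ a = 0 → 0 ≤ f a) {x : M} (hx : x ∈ posRoots b)
    (hxθ : B.form θ x = 0) : 0 ≤ f x := by
  obtain ⟨c, hc, hsum⟩ := H.exists_sum_of_pos hx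
  have hnn : ∀ j ∈ b.support, 0 ≤ (c j : ℚ) * B.form θ (P.root j) := fun j hj ↦
    mul_nonneg (by exact_mod_cast hc j) (H.theta_nonneg (H.simple_mem ⟨j, hj, rfl⟩).1)
  have hs : ∑ j ∈ b.support, (c j : ℚ) * B.form θ (P.root j) = 0 := by
    rw [← hxθ, hsum, map_sum]
    exact Finset.sum_congr rfl fun j _ ↦ by rw [map_zsmul, zsmul_eq_mul]
  rw [hsum, map_sum]
  refine Finset.sum_nonneg fun j hj ↦ ?_
  rw [map_zsmul, zsmul_eq_mul]
  rcases mul_eq_zero.1 ((Finset.sum_eq_zero_iff_of_nonneg hnn).1 hs j hj) with h1 | h1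
  · rw [h1, zero_mul]
  · exact mul_nonneg (by exact_mod_cast hc j) (hf _ ⟨j, hj, rfl⟩ h1)

/-- A positive root orthogonal to `θ` involves only simple roots orthogonal to `θ`, because `θ` is
dominant; so the functional `x ↦ h (w x)` is nonnegative on it. -/
theorem Setting.smul_pos_of_orthogonal (H : Setting b B θ h) {w : P.weylGroup}
    (hw : ∀ a ∈ simpleRoots b, B.form θ a = 0 → w • a ∈ posRoots b) {x : M} (hx : x ∈ posRoots b)
    (hxθ : B.form θ x = 0) : w • x ∈ posRoots b := by
  have hwx := smul_mem_roots w (H.root_of_pos hx)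
  refine (H.pos_or_neg hwx).resolve_right fun hneg ↦ ?_
  have h1 := H.functional_nonneg (h ∘ₗ (DistribSMul.toLinearMap ℚ M w))
    (fun a ha haθ ↦ zero_le_one.trans (H.one_le_height (hw a ha haθ))) hx hxθ
  have h2 := H.one_le_height hneg
  rw [map_neg] at h2
  change 0 ≤ h (w • x) at h1
  linarith

theorem Setting.pos_of_smul_pos (H : Setting b B θ h) {w : P.weylGroup}
    (hw : ∀ a ∈ simpleRoots b, B.form θ a = 0 → w • a ∈ posRoots b) {x : M} (hx : x ∈ roots P)
    (hxθ : B.form θ x = 0) (hwx : w • x ∈ posRoots b) : x ∈ posRoots b := by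
  refine (H.pos_or_neg hx).resolve_right fun hneg ↦ ?_
  have := H.smul_pos_of_orthogonal hw hneg (by rw [map_neg, hxθ, neg_zero])
  rw [smul_neg] at this
  exact H.neg_notMem hwx this

variable [P.IsReduced]

/-- Every root is reached from the simple ones by simple reflections, and reflecting a root
conjugates its reflection. -/
theorem weylGroup_exists_word (b : P.Base) (u : P.weylGroup) :
    ∃ l : List ι, (∀ i ∈ l, i ∈ b.support) ∧ u = (l.map (weylGroup.ofIdx P)).prod := by
  have hmul : ∀ u v : P.weylGroup,
      (∃ l : List ι, (∀ i ∈ l, i ∈ b.support) ∧ u = (l.map (weylGroup.ofIdx P)).prod) →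
      (∃ l : List ι, (∀ i ∈ l, i ∈ b.support) ∧ v = (l.map (weylGroup.ofIdx P)).prod) →
      ∃ l : List ι, (∀ i ∈ l, i ∈ b.support) ∧ u * v = (l.map (weylGroup.ofIdx P)).prod := by
    rintro _ _ ⟨l, hl, rfl⟩ ⟨m, hm, rfl⟩
    refine ⟨l ++ m, fun i hi ↦ ?_, by simp⟩
    rcases List.mem_append.1 hi with h1 | h1
    exacts [hl i h1, hm i h1]
  have hgen : ∀ i, ∃ l : List ι, (∀ i ∈ l, i ∈ b.support) ∧
      weylGroup.ofIdx P i = (l.map (weylGroup.ofIdx P)).prod := by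
    intro i
    have h1 : ∀ i ∈ b.support, ∃ l : List ι, (∀ i ∈ l, i ∈ b.support) ∧
        weylGroup.ofIdx P i = (l.map (weylGroup.ofIdx P)).prod := fun j hj ↦
      ⟨[j], by simpa using hj, by simp⟩
    refine b.induction_reflect i ?_ h1 ?_
    · intro j hj
      rw [ofIdx_reflectionPerm, ofIdx_mul_self, one_mul]
      exact hj
    · intro j k hj hk
      rw [ofIdx_reflectionPerm]
      exact hmul _ _ (hmul _ _ (h1 k hk) hj) (h1 k hk)
  obtain ⟨u, hu⟩ := u
  induction hu using weylGroup.induction with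
  | mem i => exact hgen i
  | one => exact ⟨[], by simp, rfl⟩
  | mul x y hx hy ihx ihy => exact hmul ⟨x, hx⟩ ⟨y, hy⟩ ihx ihy

namespace Setting

theorem isSimpleSystem_weylGroup (H : Setting b B θ h) :
    IsSimpleSystem (posRoots b) (b.support : Set ι) P.root (weylGroup.ofIdx P) where
  mem_pos i hi := (H.simple_mem ⟨i, hi, rfl⟩).1
  neg_notMem _ hx := H.neg_notMem hx
  mul_self i _ := ofIdx_mul_self i
  smul_self i _ := P.reflection_apply_self i
  smul_pos := by
    rintro i hi _ ⟨j, hj, rfl⟩ hne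
    exact ⟨P.reflectionPerm i j, Base.IsPos.reflectionPerm hj hi fun he ↦ hne (by rw [he]),
      P.root_reflectionPerm i j⟩
  conj := by
    intro i _ j _ l _ hij
    generalize (l.map (weylGroup.ofIdx P)).prod = g at hij
    refine weylGroup_ext fun x ↦ ?_
    rw [mul_smul, mul_smul, ofIdx_smul_eq, ofIdx_smul_eq, smul_sub, weyl_smul_smul, hij]
    congr 2
    refine mul_right_cancel₀ (B.ne_zero j) ?_
    rw [← two_mul_form_root, ← hij, weyl_form, weyl_form, two_mul_form_root]

theorem exists_weylLength_eq (_H : Setting b B θ h) (u : P.weylGroup) :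
    ∃ l : List ι, l.length = weylLength b u ∧ (∀ i ∈ l, i ∈ b.support) ∧
      u = (l.map (weylGroup.ofIdx P)).prod := by
  obtain ⟨l, hl, hu⟩ := weylGroup_exists_word b u
  exact Nat.sInf_mem (s := {n | ∃ l : List ι, l.length = n ∧ (∀ i ∈ l, i ∈ b.support) ∧
    u = (l.map (weylGroup.ofIdx P)).prod}) ⟨l.length, l, rfl, hl, hu⟩

/-- If `w • a` were negative, exchange would drop a letter and yield `w s_a`, which also takes `θ`
to `μ` because `s_a` fixes `θ`. -/
theorem smul_pos_of_isShortestTo (H : Setting b B θ h) {μ : M} {w : P.weylGroup}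
    (hw : IsShortestTo b θ μ w) {a : M} (ha : a ∈ simpleRoots b) (haθ : B.form θ a = 0) :
    w • a ∈ posRoots b := by
  obtain ⟨i, hi, rfl⟩ := ha
  refine (H.pos_or_neg (smul_mem_roots w ⟨i, rfl⟩)).resolve_right fun hneg ↦ ?_
  obtain ⟨l, hlen, hl, rfl⟩ := H.exists_weylLength_eq w
  obtain ⟨l', hl', hlen', hprod⟩ := H.isSimpleSystem_weylGroup.exchange hl hi hneg
  have hfix : weylGroup.ofIdx P i • θ = θ := by
    have := two_mul_form_root B θ i
    rw [haθ, mul_zero] at this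
    rw [ofIdx_smul_eq, (mul_eq_zero.1 this.symm).resolve_right (B.ne_zero i), zero_smul, sub_zero]
  have h1 := hw.2 (l'.map (weylGroup.ofIdx P)).prod (by
    rw [← hw.1, hprod, mul_smul, hfix])
  have h2 : weylLength b (l'.map (weylGroup.ofIdx P)).prod ≤ l'.length :=
    Nat.sInf_le ⟨l', rfl, hl', rfl⟩
  omega

/-- The element `u⁻¹ v` fixes `θ` and keeps every simple root positive: those orthogonal to `θ` by
the positivity of `u` and `v`, the others because their images still pair positively with `θ`. By
`prod_eq_one` it is trivial. Together with `smul_pos_of_isShortestTo` this gives uniqueness of the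
shortest element. -/
theorem eq_of_smul_theta_eq (H : Setting b B θ h) {u v : P.weylGroup} (huv : u • θ = v • θ)
    (hu : ∀ a ∈ simpleRoots b, B.form θ a = 0 → u • a ∈ posRoots b)
    (hv : ∀ a ∈ simpleRoots b, B.form θ a = 0 → v • a ∈ posRoots b) : u = v := by
  obtain ⟨l, hl, hprod⟩ := weylGroup_exists_word b (u⁻¹ * v)
  have hθ : (u⁻¹ * v)⁻¹ • θ = θ := by
    rw [mul_inv_rev, inv_inv, mul_smul, huv, inv_smul_smul]
  have key : u⁻¹ * v = 1 := by
    rw [hprod]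
    refine H.isSimpleSystem_weylGroup.prod_eq_one hl fun i hi ↦ ?_
    rw [← hprod]
    have hr : (u⁻¹ * v) • P.root i ∈ roots P := smul_mem_roots _ ⟨i, rfl⟩
    have hB : B.form θ ((u⁻¹ * v) • P.root i) = B.form θ (P.root i) := by
      rw [← weyl_form_inv, hθ]
    have hpi := (H.simple_mem ⟨i, hi, rfl⟩).1
    rcases (H.theta_nonneg hpi).eq_or_lt' with h0 | h0
    · refine H.pos_of_smul_pos hu hr (by rw [hB, h0]) ?_
      rw [mul_smul, smul_inv_smul]
      exact hv _ ⟨i, hi, rfl⟩ h0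
    · exact H.pos_of_theta hr (by rw [hB]; exact h0)
  exact (inv_mul_eq_one.1 key)

end Setting

end Weyl

/-! ### Affine roots, affine reflections, and the affine Weyl group. -/

section Affine

variable {ι M N : Type*} [AddCommGroup M] [Module ℚ M] [AddCommGroup N] [Module ℚ N]
  {P : RootPairing ι ℚ M N} {b : P.Base} {B : P.InvariantForm} {θ : M} {h : M →ₗ[ℚ] ℚ}

/-- The functional `x ↦ (x, a)` on the affine space. -/
def affinePairing (B : LinearMap.BilinForm ℚ M) (a : M × ℚ × ℚ) : (M × ℚ × ℚ) →ₗ[ℚ] ℚ :=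
  B.flip a.1 ∘ₗ LinearMap.fst ℚ M (ℚ × ℚ) +
    a.2.2 • (LinearMap.fst ℚ ℚ ℚ ∘ₗ LinearMap.snd ℚ M (ℚ × ℚ)) +
    a.2.1 • (LinearMap.snd ℚ ℚ ℚ ∘ₗ LinearMap.snd ℚ M (ℚ × ℚ))

theorem affinePairing_apply (B : LinearMap.BilinForm ℚ M) (a x : M × ℚ × ℚ) :
    affinePairing B a x = affineForm B x a := by
  simp [affinePairing, affineForm, mul_comm]

theorem affineForm_sub_smul_left (B : LinearMap.BilinForm ℚ M) (x a y : M × ℚ × ℚ) (t : ℚ) :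
    affineForm B (x - t • a) y = affineForm B x y - t * affineForm B a y := by
  simp only [← affinePairing_apply, map_sub, map_smul, smul_eq_mul]

theorem affineForm_symm (H : Setting b B θ h) (x y : M × ℚ × ℚ) :
    affineForm B.form x y = affineForm B.form y x := by
  simp only [affineForm, H.symm x.1]
  ring

open Classical in
/-- The reflection of the affine space in a nonisotropic vector `a`. -/
def affineReflection (B : LinearMap.BilinForm ℚ M) (a : M × ℚ × ℚ) :
    (M × ℚ × ℚ) ≃ₗ[ℚ] (M × ℚ × ℚ) :=
  if ha : ((2 / affineForm B a a) • affinePairing B a) a = 2 then Module.reflection ha else 1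

theorem affineReflection_apply {B : LinearMap.BilinForm ℚ M} {a : M × ℚ × ℚ}
    (ha : affineForm B a a ≠ 0) (x : M × ℚ × ℚ) :
    affineReflection B a x = x - (2 * affineForm B x a / affineForm B a a) • a := by
  have h2 : ((2 / affineForm B a a) • affinePairing B a) a = 2 := by
    rw [LinearMap.smul_apply, affinePairing_apply, smul_eq_mul, div_mul_cancel₀ _ ha]
  rw [affineReflection, dif_pos h2, Module.reflection_apply, LinearMap.smul_apply,
    affinePairing_apply, smul_eq_mul]
  congr 2
  ring

theorem isReflectionIn_iff {B : LinearMap.BilinForm ℚ M} {a : M × ℚ × ℚ}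
    (ha : affineForm B a a ≠ 0) {s : (M × ℚ × ℚ) ≃ₗ[ℚ] (M × ℚ × ℚ)} :
    IsReflectionIn B a s ↔ s = affineReflection B a := by
  constructor
  · intro hs
    ext1 x
    rw [hs x, affineReflection_apply ha]
  · rintro rfl x
    exact affineReflection_apply ha x

theorem affineReflection_self {B : LinearMap.BilinForm ℚ M} {a : M × ℚ × ℚ}
    (ha : affineForm B a a ≠ 0) : affineReflection B a a = -a := by
  rw [affineReflection_apply ha, mul_div_cancel_right₀ _ ha, two_smul]
  abel

theorem affineReflection_mul_self {B : LinearMap.BilinForm ℚ M} {a : M × ℚ × ℚ}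
    (ha : affineForm B a a ≠ 0) : affineReflection B a * affineReflection B a = 1 := by
  ext1 x
  rw [LinearEquiv.mul_apply, affineReflection_apply ha x, map_sub, map_smul,
    affineReflection_self ha, affineReflection_apply ha x]
  simp

theorem affineForm_affineReflection (H : Setting b B θ h) {a : M × ℚ × ℚ}
    (ha : affineForm B.form a a ≠ 0) (x y : M × ℚ × ℚ) :
    affineForm B.form (affineReflection B.form a x) (affineReflection B.form a y) =
      affineForm B.form x y := by
  have hr : ∀ z t, affineForm B.form z (y - t • a) =
      affineForm B.form z y - t * affineForm B.form z a := fun z t ↦ by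
    rw [affineForm_symm H z, affineForm_sub_smul_left, affineForm_symm H y, affineForm_symm H a]
  rw [affineReflection_apply ha, affineReflection_apply ha, affineForm_sub_smul_left, hr, hr,
    affineForm_symm H a y]
  field_simp
  ring

theorem affineReflection_eq_self {B : LinearMap.BilinForm ℚ M} {a x : M × ℚ × ℚ}
    (ha : affineForm B a a ≠ 0) (hx : affineForm B x a = 0) : affineReflection B a x = x := by
  rw [affineReflection_apply ha, hx]
  simp

theorem affineReflection_delta {B : LinearMap.BilinForm ℚ M} {α : M} {k : ℚ}
    (hα : B α α ≠ 0) : affineReflection B (α, k, 0) delta = delta := by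
  refine affineReflection_eq_self ?_ ?_ <;> simp [affineForm, delta, hα]

theorem affineReflection_root {B : LinearMap.BilinForm ℚ M} {α β : M} {k m n : ℚ}
    (hα : B α α ≠ 0) (hn : 2 * B β α = n * B α α) :
    affineReflection B (α, k, 0) (β, m, 0) = (β - n • α, m - n * k, 0) := by
  rw [affineReflection_apply (by simpa [affineForm] using hα)]
  have : 2 * affineForm B (β, m, 0) (α, k, 0) / affineForm B (α, k, 0) (α, k, 0) = n := by
    simp [affineForm, hn, hα]
  rw [this]
  simp

/-- The real affine roots. -/
def affineRoots (P : RootPairing ι ℚ M N) : Set (M × ℚ × ℚ) :=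
  {x | ∃ α ∈ roots P, ∃ k : ℤ, x = (α, (k : ℚ), 0)}

theorem affineForm_self_ne_zero (H : Setting b B θ h) {a : M × ℚ × ℚ} (ha : a ∈ affineRoots P) :
    affineForm B.form a a ≠ 0 := by
  obtain ⟨α, hα, k, rfl⟩ := ha
  simpa [affineForm] using (H.self_pos hα).ne'

theorem alphaZero_eq {V : Type*} [AddCommGroup V] (θ : V) : alphaZero θ = (-θ, 1, 0) := by
  simp [alphaZero, delta, incl]

theorem incl_eq {V : Type*} (v : V) : incl v = (v, 0, 0) := rfl

theorem delta_sub_incl {V : Type*} [AddCommGroup V] (v : V) : delta - incl v = (-v, 1, 0) := by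
  simp [delta, incl]

theorem affineSimpleRoots_subset (H : Setting b B θ h) :
    affineSimpleRoots b θ ⊆ affineRoots P := by
  rintro _ (rfl | ⟨x, hx, rfl⟩)
  · exact ⟨-θ, H.neg_mem H.theta_mem, 1, by simp [alphaZero_eq]⟩
  · exact ⟨x, H.root_of_pos (H.simple_mem hx).1, 0, by simp [incl_eq]⟩

theorem neg_mem_affineRoots (H : Setting b B θ h) {x : M × ℚ × ℚ} (hx : x ∈ affineRoots P) :
    -x ∈ affineRoots P := by
  obtain ⟨α, hα, k, rfl⟩ := hx
  exact ⟨-α, H.neg_mem hα, -k, by simp⟩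

theorem mem_affinePosRoots (H : Setting b B θ h) {x : M × ℚ × ℚ} :
    x ∈ affinePosRoots b ↔ ∃ α ∈ roots P, ∃ k : ℤ, x = (α, (k : ℚ), 0) ∧
      (1 ≤ k ∨ k = 0 ∧ α ∈ posRoots b) := by
  constructor
  · rintro (⟨α, hα, rfl⟩ | ⟨α, hα, k, hk, rfl⟩)
    · exact ⟨α, H.root_of_pos hα, 0, by simp [incl_eq], Or.inr ⟨rfl, hα⟩⟩
    · exact ⟨α, hα, k, by simp [incl_eq, delta], Or.inl (by exact_mod_cast hk)⟩
  · rintro ⟨α, hα, k, rfl, hk | ⟨rfl, hα⟩⟩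
    · obtain ⟨n, rfl⟩ := Int.eq_ofNat_of_zero_le (show 0 ≤ k by omega)
      exact Or.inr ⟨α, hα, n, by omega, by simp [incl_eq, delta]⟩
    · exact Or.inl ⟨α, hα, by simp [incl_eq]⟩

theorem mk_mem_affinePosRoots (H : Setting b B θ h) {α : M} {k : ℤ} :
    (α, (k : ℚ), (0 : ℚ)) ∈ affinePosRoots b ↔ α ∈ roots P ∧ (1 ≤ k ∨ k = 0 ∧ α ∈ posRoots b) := by
  rw [mem_affinePosRoots H]
  constructor
  · rintro ⟨α', hα, k', heq, hk⟩
    simp only [Prod.mk.injEq, Int.cast_inj, and_true] at heq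
    obtain ⟨rfl, rfl⟩ := heq
    exact ⟨hα, hk⟩
  · rintro ⟨hα, hk⟩
    exact ⟨α, hα, k, rfl, hk⟩

theorem incl_mem_affinePosRoots (H : Setting b B θ h) {α : M} :
    incl α ∈ affinePosRoots b ↔ α ∈ posRoots b := by
  have := mk_mem_affinePosRoots H (α := α) (k := 0)
  rw [Int.cast_zero, ← incl_eq] at this
  rw [this]
  exact ⟨fun h1 ↦ by simpa using h1.2, fun h1 ↦ ⟨H.root_of_pos h1, Or.inr ⟨rfl, h1⟩⟩⟩

theorem delta_sub_incl_mem (H : Setting b B θ h) {α : M} (hα : α ∈ roots P) :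
    delta - incl α ∈ affinePosRoots b := by
  have := (mk_mem_affinePosRoots H (α := -α) (k := 1)).2 ⟨H.neg_mem hα, Or.inl le_rfl⟩
  rwa [Int.cast_one, ← delta_sub_incl] at this

theorem mem_affineRoots_of_pos (H : Setting b B θ h) {x : M × ℚ × ℚ}
    (hx : x ∈ affinePosRoots b) : x ∈ affineRoots P := by
  obtain ⟨α, hα, k, rfl, -⟩ := (mem_affinePosRoots H).1 hx
  exact ⟨α, hα, k, rfl⟩

/-- The height function on the affine space. -/
def affineHeight (h : M →ₗ[ℚ] ℚ) (θ : M) : (M × ℚ × ℚ) →ₗ[ℚ] ℚ :=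
  h ∘ₗ LinearMap.fst ℚ M (ℚ × ℚ) +
    -- Giving `δ` height `h θ + 1` makes `α₀ = δ - θ` of height one, like the other simple roots.
    (h θ + 1) • (LinearMap.fst ℚ ℚ ℚ ∘ₗ LinearMap.snd ℚ M (ℚ × ℚ))

theorem affineHeight_pos (H : Setting b B θ h) {x : M × ℚ × ℚ} (hx : x ∈ affinePosRoots b) :
    0 < affineHeight h θ x := by
  obtain ⟨α, hα, k, rfl, hk⟩ := (mem_affinePosRoots H).1 hx
  have h1 : affineHeight h θ (α, (k : ℚ), 0) = h α + (h θ + 1) * k := by simp [affineHeight]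
  rw [h1]
  rcases hk with hk | ⟨rfl, hα⟩
  · have h2 := (H.height_le (H.neg_mem hα)).1
    have h3 := H.one_le_height H.theta_pos
    rw [map_neg] at h2
    have hk' : (1 : ℚ) ≤ k := by exact_mod_cast hk
    nlinarith
  · rw [Int.cast_zero]
    linarith [H.one_le_height hα]

theorem affine_pos_or_neg (H : Setting b B θ h) {x : M × ℚ × ℚ} (hx : x ∈ affineRoots P) :
    x ∈ affinePosRoots b ∨ -x ∈ affinePosRoots b := by
  obtain ⟨α, hα, k, rfl⟩ := hx
  have hneg : -(α, (k : ℚ), (0 : ℚ)) = (-α, ((-k : ℤ) : ℚ), 0) := by simp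
  rw [hneg, mk_mem_affinePosRoots H, mk_mem_affinePosRoots H]
  rcases lt_trichotomy k 0 with hk | rfl | hk
  · exact Or.inr ⟨H.neg_mem hα, Or.inl (by omega)⟩
  · rcases H.pos_or_neg hα with h1 | h1
    · exact Or.inl ⟨hα, Or.inr ⟨rfl, h1⟩⟩
    · exact Or.inr ⟨H.neg_mem hα, Or.inr ⟨by simp, h1⟩⟩
  · exact Or.inl ⟨hα, Or.inl (by omega)⟩

theorem affine_neg_notMem (H : Setting b B θ h) {x : M × ℚ × ℚ} (hx : x ∈ affinePosRoots b) :
    -x ∉ affinePosRoots b := by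
  intro h1
  have h2 := affineHeight_pos H hx
  have h3 := affineHeight_pos H h1
  rw [map_neg] at h3
  linarith

theorem affine_pos_of_add_eq (H : Setting b B θ h) {x y z : M × ℚ × ℚ}
    (hx : x ∈ affinePosRoots b) (hy : y ∈ affinePosRoots b) (hz : z ∈ affineRoots P)
    (hxyz : x + y = z) : z ∈ affinePosRoots b := by
  refine (affine_pos_or_neg H hz).resolve_right fun hn ↦ ?_
  have h1 := affineHeight_pos H hx
  have h2 := affineHeight_pos H hy
  have h3 := affineHeight_pos H hn
  rw [← hxyz, map_neg, map_add] at h3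
  linarith

section Words

variable [P.IsCrystallographic]

theorem affineReflection_mem_affineRoots (H : Setting b B θ h) {a x : M × ℚ × ℚ}
    (ha : a ∈ affineRoots P) (hx : x ∈ affineRoots P) :
    affineReflection B.form a x ∈ affineRoots P := by
  obtain ⟨α, hα, k, rfl⟩ := ha
  obtain ⟨β, hβ, m, rfl⟩ := hx
  obtain ⟨n, hn, hmem⟩ := H.exists_pairing hβ hα
  rw [affineReflection_root (H.self_pos hα).ne' hn]
  exact ⟨_, hmem, m - n * k, by push_cast; rfl⟩

/-- The properties shared by all elements of the affine Weyl group. -/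
structure IsAffineAutomorphism (B : P.InvariantForm)
    (g : (M × ℚ × ℚ) ≃ₗ[ℚ] (M × ℚ × ℚ)) : Prop where
  form : ∀ x y, affineForm B.form (g x) (g y) = affineForm B.form x y
  delta : g delta = delta
  mapsTo : ∀ x ∈ affineRoots P, g x ∈ affineRoots P

theorem isAffineAutomorphism_reflection (H : Setting b B θ h) {a : M × ℚ × ℚ}
    (ha : a ∈ affineRoots P) : IsAffineAutomorphism B (affineReflection B.form a) where
  form := affineForm_affineReflection H (affineForm_self_ne_zero H ha)
  delta := by
    obtain ⟨α, hα, k, rfl⟩ := ha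
    exact affineReflection_delta (H.self_pos hα).ne'
  mapsTo _ hx := affineReflection_mem_affineRoots H ha hx

theorem isAffineAutomorphism_word (H : Setting b B θ h) {l : List (M × ℚ × ℚ)}
    (hl : ∀ a ∈ l, a ∈ affineSimpleRoots b θ) :
    IsAffineAutomorphism B (l.map (affineReflection B.form)).prod := by
  induction l with
  | nil => exact ⟨fun _ _ ↦ rfl, rfl, fun _ hx ↦ hx⟩
  | cons a l ih =>
    have h1 := ih fun c hc ↦ hl c (by simp [hc])
    have h2 := isAffineAutomorphism_reflection H (affineSimpleRoots_subset H (hl a (by simp)))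
    rw [List.map_cons, List.prod_cons]
    exact ⟨fun x y ↦ by rw [LinearEquiv.mul_apply, LinearEquiv.mul_apply, h2.form, h1.form],
      by rw [LinearEquiv.mul_apply, h1.delta, h2.delta], fun x hx ↦ h2.mapsTo _ (h1.mapsTo x hx)⟩

end Words

/-- A long root has Cartan integer at most one with any other root. -/
theorem Setting.pairing_le_one (H : Setting b B θ h) {x y : M} (hle : B.form x x ≤ B.form y y)
    (hy : y ∈ roots P) (hne : x ≠ y) {n : ℤ} (hn : 2 * B.form x y = n * B.form y y) : n ≤ 1 := by
  have h1 := H.pos_def _ (sub_ne_zero.2 hne)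
  have h2 := H.symm x y
  have h3 := H.self_pos hy
  simp only [map_sub, LinearMap.sub_apply] at h1
  have h4 : (n : ℚ) * B.form y y < 2 * B.form y y := by linarith
  have h5 : (n : ℚ) < 2 := lt_of_mul_lt_mul_right h4 h3.le
  have h6 : n < 2 := by exact_mod_cast h5
  omega

theorem affineReflection_mem (H : Setting b B θ h) {a : M × ℚ × ℚ}
    (ha : a ∈ affineSimpleRoots b θ) : affineReflection B.form a ∈ affineWeylGroup b B.form θ :=
  Subgroup.subset_closure ⟨a, ha,
    (isReflectionIn_iff (affineForm_self_ne_zero H (affineSimpleRoots_subset H ha))).2 rfl⟩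

/-- The extension of an element of the finite Weyl group to the affine space. -/
def affineLift (u : P.weylGroup) : (M × ℚ × ℚ) ≃ₗ[ℚ] (M × ℚ × ℚ) :=
  (DistribMulAction.toLinearEquiv ℚ M u).prodCongr (LinearEquiv.refl ℚ (ℚ × ℚ))

theorem affineLift_apply (u : P.weylGroup) (x : M × ℚ × ℚ) :
    affineLift u x = (u • x.1, x.2) := rfl

theorem affineLift_incl (u : P.weylGroup) (v : M) : affineLift u (incl v) = incl (u • v) := rfl

theorem affineLift_mul (u v : P.weylGroup) :
    affineLift (u * v) = affineLift u * affineLift v := by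
  ext1 x
  simp [affineLift_apply, LinearEquiv.mul_apply, mul_smul]

theorem affineLift_ofIdx (i : ι) :
    affineLift (weylGroup.ofIdx P i) = affineReflection B.form (incl (P.root i)) := by
  ext1 x
  have h1 : affineForm B.form (incl (P.root i)) (incl (P.root i)) =
      B.form (P.root i) (P.root i) := by simp [affineForm, incl_eq]
  have h2 : 2 * affineForm B.form x (incl (P.root i)) =
      P.coroot' i x.1 * B.form (P.root i) (P.root i) := by
    rw [← two_mul_form_root]
    simp [affineForm, incl_eq]
  rw [affineReflection_apply (by rw [h1]; exact B.ne_zero i), h1, h2,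
    mul_div_cancel_right₀ _ (B.ne_zero i), affineLift_apply, ofIdx_smul_eq]
  ext <;> simp [incl_eq]

variable [Finite ι] [P.IsCrystallographic] [P.IsReduced]

/-- This makes exchange available in the affine Weyl group. The length assumption on `θ` bounds
Cartan integers against `θ`, so that the reflection in `α₀` makes no positive root other than `α₀`
negative. -/
theorem isSimpleSystem_affine (H : Setting b B θ h)
    (hlong : ∀ β ∈ roots P, B.form β β ≤ B.form θ θ) :
    IsSimpleSystem (affinePosRoots b) (affineSimpleRoots b θ) id (affineReflection B.form) where
  mem_pos := by
    rintro _ (rfl | ⟨x, hx, rfl⟩)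
    · exact delta_sub_incl_mem H H.theta_mem
    · exact (incl_mem_affinePosRoots H).2 (H.simple_mem hx).1
  neg_notMem _ hx := affine_neg_notMem H hx
  mul_self a ha :=
    affineReflection_mul_self (affineForm_self_ne_zero H (affineSimpleRoots_subset H ha))
  smul_self a ha :=
    affineReflection_self (affineForm_self_ne_zero H (affineSimpleRoots_subset H ha))
  smul_pos := by
    rintro _ (rfl | ⟨α, hα, rfl⟩) x hx hne
    · obtain ⟨β, hβ, m, rfl, hm⟩ := (mem_affinePosRoots H).1 hx
      obtain ⟨n, hn, hmem⟩ := H.exists_pairing hβ H.theta_mem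
      have hθθ := H.self_pos H.theta_mem
      have hs : affineReflection B.form (alphaZero θ) (β, (m : ℚ), 0) =
          (β - (n : ℚ) • θ, ((m + n : ℤ) : ℚ), 0) := by
        rw [alphaZero_eq, affineReflection_root (n := -n) (by simpa using hθθ.ne')
          (by simp only [map_neg, LinearMap.neg_apply, neg_neg]; linarith)]
        simp
      change affineReflection B.form (alphaZero θ) (β, (m : ℚ), 0) ∈ _
      rw [hs, mk_mem_affinePosRoots H]
      refine ⟨hmem, ?_⟩
      have hlev : B.form θ (β - (n : ℚ) • θ) = -B.form θ β := by
        rw [map_sub, map_smul, smul_eq_mul, H.symm θ β]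
        linarith
      have hn' : 2 * B.form (-β) θ = ((-n : ℤ) : ℚ) * B.form θ θ := by
        rw [map_neg, LinearMap.neg_apply]
        push_cast
        linarith
      -- The level changes from `m` to `m + n`. Only `n < 0` is delicate: then `m ≥ 1`, and `n = -1`
      -- unless `β = -θ`. In that case `n = -2`, but `m ≥ 2` because the root is not `α₀`.
      rcases lt_trichotomy n 0 with h0 | rfl | h0
      · have hneg : B.form θ β < 0 := by
          have : (n : ℚ) < 0 := by exact_mod_cast h0
          rw [H.symm]
          linarith [mul_neg_of_neg_of_pos this hθθ]
        have hm1 : 1 ≤ m := by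
          rcases hm with hm | ⟨-, hm⟩
          · exact hm
          · exact absurd (H.theta_nonneg hm) (not_le.2 hneg)
        have hpos : β - (n : ℚ) • θ ∈ posRoots b := H.pos_of_theta hmem (by rw [hlev]; linarith)
        suffices 0 ≤ m + n by
          rcases this.eq_or_lt' with h1 | h1
          · exact Or.inr ⟨h1, hpos⟩
          · exact Or.inl h1
        by_cases hβθ : -β = θ
        · have hβ' : β = -θ := by rw [← hβθ, neg_neg]
          subst hβ'
          have hm2 : m ≠ 1 := by
            rintro rfl
            exact hne (by simp [alphaZero_eq])
          have hn2 : n = -2 := by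
            have : ((n + 2 : ℤ) : ℚ) * B.form θ θ = 0 := by
              rw [map_neg, LinearMap.neg_apply] at hn
              push_cast
              linarith
            have : ((n + 2 : ℤ) : ℚ) = 0 := (mul_eq_zero.1 this).resolve_right hθθ.ne'
            have : n + 2 = 0 := by exact_mod_cast this
            omega
          omega
        · have := H.pairing_le_one (by simpa using hlong β hβ) H.theta_mem hβθ hn'
          omega
      · simpa using hm
      · rcases hm with hm | ⟨rfl, -⟩ <;> exact Or.inl (by omega)
    · obtain ⟨β, hβ, m, rfl, hm⟩ := (mem_affinePosRoots H).1 hx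
      have hαr := H.root_of_pos (H.simple_mem hα).1
      obtain ⟨n, hn, hmem⟩ := H.exists_pairing hβ hαr
      have hs : affineReflection B.form (incl α) (β, (m : ℚ), 0) =
          (β - (n : ℚ) • α, (m : ℚ), 0) := by
        rw [incl_eq, affineReflection_root (H.self_pos hαr).ne' hn]
        simp
      change affineReflection B.form (incl α) (β, (m : ℚ), 0) ∈ _
      rw [hs, mk_mem_affinePosRoots H]
      refine ⟨hmem, hm.imp_right ?_⟩
      rintro ⟨rfl, hβp⟩
      refine ⟨rfl, H.reflection_pos hβp hα ?_ hn⟩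
      rintro rfl
      exact hne (by simp [incl_eq])
  conj := by
    intro a ha c hc l hl hac
    have hg := isAffineAutomorphism_word H hl
    generalize (l.map (affineReflection B.form)).prod = g at hac hg
    have ha0 := affineForm_self_ne_zero H (affineSimpleRoots_subset H ha)
    have hc0 := affineForm_self_ne_zero H (affineSimpleRoots_subset H hc)
    change g a = c at hac
    ext1 x
    rw [LinearEquiv.mul_apply, LinearEquiv.mul_apply, affineReflection_apply ha0,
      affineReflection_apply hc0, map_sub, map_smul, ← hac, hg.form, hg.form]

theorem exists_word_of_mem_affineWeylGroup (H : Setting b B θ h)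
    (hlong : ∀ β ∈ roots P, B.form β β ≤ B.form θ θ) {w : (M × ℚ × ℚ) ≃ₗ[ℚ] (M × ℚ × ℚ)}
    (hw : w ∈ affineWeylGroup b B.form θ) :
    ∃ l : List (M × ℚ × ℚ), (∀ a ∈ l, a ∈ affineSimpleRoots b θ) ∧
      w = (l.map (affineReflection B.form)).prod := by
  induction hw using Subgroup.closure_induction with
  | mem s hs =>
    obtain ⟨a, ha, hs⟩ := hs
    refine ⟨[a], by simpa using ha, ?_⟩
    rw [isReflectionIn_iff (affineForm_self_ne_zero H (affineSimpleRoots_subset H ha))] at hs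
    simpa using hs
  | one => exact ⟨[], by simp, by simp⟩
  | mul x y _ _ hx hy =>
    obtain ⟨l, hl, rfl⟩ := hx
    obtain ⟨m, hm, rfl⟩ := hy
    refine ⟨l ++ m, fun a ha ↦ ?_, by simp⟩
    rcases List.mem_append.1 ha with h1 | h1
    exacts [hl a h1, hm a h1]
  | inv x _ hx =>
    obtain ⟨l, hl, rfl⟩ := hx
    exact ⟨l.reverse, fun a ha ↦ hl a (List.mem_reverse.1 ha),
      (isSimpleSystem_affine H hlong).inv_prod hl⟩

theorem isAffineAutomorphism_of_mem (H : Setting b B θ h)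
    (hlong : ∀ β ∈ roots P, B.form β β ≤ B.form θ θ) {w : (M × ℚ × ℚ) ≃ₗ[ℚ] (M × ℚ × ℚ)}
    (hw : w ∈ affineWeylGroup b B.form θ) : IsAffineAutomorphism B w := by
  obtain ⟨l, hl, rfl⟩ := exists_word_of_mem_affineWeylGroup H hlong hw
  exact isAffineAutomorphism_word H hl

theorem affineLift_mem (H : Setting b B θ h) (u : P.weylGroup) :
    affineLift u ∈ affineWeylGroup b B.form θ := by
  obtain ⟨l, hl, rfl⟩ := weylGroup_exists_word b u
  induction l with
  | nil =>
    have : affineLift (1 : P.weylGroup) = 1 := by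
      ext1 x
      simp [affineLift_apply]
    simp [this]
  | cons i l ih =>
    rw [List.map_cons, List.prod_cons, affineLift_mul, affineLift_ofIdx (B := B)]
    refine mul_mem (affineReflection_mem H ?_) (ih fun j hj ↦ hl j (by simp [hj]))
    exact Or.inr ⟨_, ⟨i, hl i (by simp), rfl⟩, rfl⟩

end Affine

/-! ### Inversion sets in the affine Weyl group. -/

section Minuscule

variable {ι M N : Type*} [AddCommGroup M] [Module ℚ M] [AddCommGroup N] [Module ℚ N]
  {P : RootPairing ι ℚ M N} {b : P.Base} {B : P.InvariantForm} {θ : M} {h : M →ₗ[ℚ] ℚ}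

theorem incl_ne_delta_sub {V : Type*} [AddCommGroup V] (x y : V) : incl x ≠ delta - incl y := by
  intro he
  have := congrArg (fun z ↦ z.2.1) he
  simp [incl_eq, delta] at this

theorem delta_sub_incl_injective {V : Type*} [AddCommGroup V] :
    Function.Injective fun γ : V ↦ (delta - incl γ : V × ℚ × ℚ) := by
  intro x y hxy
  simpa [delta_sub_incl] using hxy

theorem incl_injective {V : Type*} : Function.Injective (incl : V → V × ℚ × ℚ) :=
  fun _ _ hxy ↦ congrArg Prod.fst hxy

theorem alphaZero_mem {b : P.Base} : alphaZero θ ∈ affineSimpleRoots b θ := Or.inl rfl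

/-- A positive root other than `θ` which is not orthogonal to `θ` pairs with `θ` to one. -/
theorem Setting.theta_sub [Finite ι] [P.IsCrystallographic] (H : Setting b B θ h)
    (hlong : ∀ β ∈ roots P, B.form β β ≤ B.form θ θ) {γ : M} (hγ : γ ∈ roots P) (hne : γ ≠ θ)
    (hγθ : 0 < B.form θ γ) : 2 * B.form γ θ = B.form θ θ ∧ θ - γ ∈ posRoots b := by
  obtain ⟨n, hn, -⟩ := H.exists_pairing hγ H.theta_mem
  have h1 := H.pairing_le_one (hlong γ hγ) H.theta_mem hne hn
  have h2 : 0 < n := by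
    rw [H.symm] at hγθ
    have : 0 < (n : ℚ) * B.form θ θ := by linarith
    exact_mod_cast (pos_iff_pos_of_mul_pos this).2 (H.self_pos H.theta_mem)
  obtain rfl : n = 1 := by omega
  rw [Int.cast_one, one_mul] at hn
  have h3 := H.self_pos H.theta_mem
  exact ⟨hn, H.pos_of_theta (H.sub_mem H.theta_mem hγ hγθ hne.symm) (by
    rw [map_sub, H.symm θ γ]; linarith)⟩

theorem affineReflection_alphaZero {γ : M} {m n : ℚ} (H : Setting b B θ h)
    (hn : 2 * B.form γ θ = n * B.form θ θ) :
    affineReflection B.form (alphaZero θ) (γ, m, 0) = (γ - n • θ, m + n, 0) := by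
  rw [alphaZero_eq, affineReflection_root (n := -n)
    (by simpa using (H.self_pos H.theta_mem).ne')
    (by simp only [map_neg, LinearMap.neg_apply, neg_neg]; linarith)]
  simp

theorem affineReflection_alphaZero_incl_theta_sub (H : Setting b B θ h) {γ : M}
    (hn : 2 * B.form γ θ = B.form θ θ) :
    affineReflection B.form (alphaZero θ) (incl (θ - γ)) = delta - incl γ := by
  rw [incl_eq, affineReflection_alphaZero H (n := 1)
    (by rw [map_sub, LinearMap.sub_apply]; linarith), delta_sub_incl]
  simp

theorem affineReflection_alphaZero_delta_sub (H : Setting b B θ h) {γ : M}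
    (hn : B.form γ θ = 0) :
    affineReflection B.form (alphaZero θ) (delta - incl γ) = delta - incl γ := by
  rw [delta_sub_incl, affineReflection_alphaZero H (n := 0) (by simp [hn])]
  simp

/-- A set of positive roots encoded by the inversions of an affine Weyl group element is an
Abelian ideal. -/
theorem isAbelianIdeal_of_inversions (H : Setting b B θ h)
    {w : (M × ℚ × ℚ) ≃ₗ[ℚ] (M × ℚ × ℚ)} (hw : IsAffineAutomorphism B w) {I : Set M}
    (hI : I ⊆ posRoots b) (hinv : inversions b w = (fun γ ↦ delta - incl γ) '' I) :
    IsAbelianIdeal b I := by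
  have hneg : ∀ γ ∈ I, -(w (delta - incl γ)) ∈ affinePosRoots b := fun γ hγ ↦
    (hinv.ge ⟨γ, hγ, rfl⟩ : delta - incl γ ∈ inversions b w).2
  refine ⟨hI, fun γ hγ ν hν hsum ↦ ?_, fun γ hγ ν hν hsum ↦ ?_⟩
  -- If `γ + ν` were a root, the sum of the inversions `δ - γ` and `δ - ν` would be an inversion
  -- with `δ`-coefficient 2, but all inversions have coefficient 1.
  · have hx : (-(γ + ν), ((2 : ℤ) : ℚ), (0 : ℚ)) ∈ affinePosRoots b :=
      (mk_mem_affinePosRoots H).2 ⟨H.neg_mem hsum, Or.inl (by norm_num)⟩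
    have hxx : (-(γ + ν), ((2 : ℤ) : ℚ), (0 : ℚ)) = (delta - incl γ) + (delta - incl ν) := by
      simp only [delta_sub_incl]
      ext
      · simp [add_comm]
      · norm_num
      · simp
    have : (-(γ + ν), ((2 : ℤ) : ℚ), (0 : ℚ)) ∈ inversions b w := by
      refine ⟨hx, affine_pos_of_add_eq H (hneg γ hγ) (hneg ν hν)
        (neg_mem_affineRoots H (hw.mapsTo _ (mem_affineRoots_of_pos H hx))) ?_⟩
      rw [hxx, map_add, neg_add]
    rw [hinv] at this
    obtain ⟨γ', -, he⟩ := this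
    have := congrArg (fun z ↦ z.2.1) he
    simp [delta_sub_incl] at this
  -- No finite root is inverted, so subtracting `ν` from the inversion `δ - γ` leaves an inversion.
  · have hνa : w (incl ν) ∈ affinePosRoots b := by
      have hνp := (incl_mem_affinePosRoots H).2 hν
      refine (affine_pos_or_neg H (hw.mapsTo _ (mem_affineRoots_of_pos H hνp))).resolve_right
        fun hn ↦ ?_
      have : incl ν ∈ inversions b w := ⟨hνp, hn⟩
      rw [hinv] at this
      obtain ⟨γ', -, he⟩ := this
      exact incl_ne_delta_sub _ _ he.symm
    have hp := delta_sub_incl_mem H hsum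
    have : delta - incl (γ + ν) ∈ inversions b w := by
      refine ⟨hp, affine_pos_of_add_eq H (hneg γ hγ) hνa
        (neg_mem_affineRoots H (hw.mapsTo _ (mem_affineRoots_of_pos H hp))) ?_⟩
      have : (delta - incl (γ + ν) : M × ℚ × ℚ) = (delta - incl γ) - incl ν := by
        simp [delta, incl_eq, sub_eq_add_neg, add_comm]
      rw [this, map_sub w (delta - incl γ)]
      abel
    rw [hinv] at this
    obtain ⟨γ', hγ', he⟩ := this
    rwa [← delta_sub_incl_injective he]

variable [Finite ι] [P.IsCrystallographic] [P.IsReduced]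

/-- An element of the affine Weyl group all of whose inversions are orthogonal to `v` fixes `v`. -/
theorem apply_eq_self_of_inversions_orthogonal (H : Setting b B θ h)
    (hlong : ∀ β ∈ roots P, B.form β β ≤ B.form θ θ) {x : (M × ℚ × ℚ) ≃ₗ[ℚ] (M × ℚ × ℚ)}
    (hx : x ∈ affineWeylGroup b B.form θ) {v : M × ℚ × ℚ}
    (hv : ∀ y ∈ inversions b x, affineForm B.form y v = 0) : x v = v := by
  have hS := isSimpleSystem_affine H hlong
  -- Induction on the length of a word `g` for `x⁻¹`. If `g a` is negative, `g = g' s_a` with `g'`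
  -- shorter, and the inversions of `g'⁻¹` are among those of `g⁻¹`, so `g'` fixes `v`. Since `-(g
  -- a)` is an inversion of `g⁻¹`, its orthogonality to `v` pulls back to that of `a`, so `s_a`
  -- fixes `v` too.
  have key : ∀ n, ∀ l : List (M × ℚ × ℚ), l.length = n → (∀ a ∈ l, a ∈ affineSimpleRoots b θ) →
      (∀ y ∈ inversions b ((l.map (affineReflection B.form)).prod)⁻¹,
        affineForm B.form y v = 0) → (l.map (affineReflection B.form)).prod v = v := by
    intro n
    induction n using Nat.strong_induction_on with
    | _ n ih =>
      intro l hn hl hv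
      have hg := isAffineAutomorphism_word H hl
      set g := (l.map (affineReflection B.form)).prod with hgdef
      by_cases hpos : ∀ a ∈ affineSimpleRoots b θ, g a ∈ affinePosRoots b
      · have := hS.prod_eq_one hl hpos
        rw [← hgdef] at this
        rw [this]
        rfl
      · push Not at hpos
        obtain ⟨a, ha, hga⟩ := hpos
        have hneg : -(g a) ∈ affinePosRoots b :=
          (hS.pos_or_neg hl (hS.mem_pos a ha)).resolve_left hga
        obtain ⟨l', hl', hlen, hprod⟩ := hS.exchange hl ha hneg
        rw [← hgdef] at hprod
        set g' := (l'.map (affineReflection B.form)).prod with hgdef'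
        have ha0 := affineForm_self_ne_zero H (affineSimpleRoots_subset H ha)
        have hss : ∀ z, affineReflection B.form a (affineReflection B.form a z) = z := fun z ↦
          LinearEquiv.congr_fun (affineReflection_mul_self ha0) z
        have hgapp : ∀ z, g z = g' (affineReflection B.form a z) := fun z ↦ by rw [hprod]; rfl
        have hinv : ∀ z, g (g⁻¹ z) = z := fun z ↦ g.apply_symm_apply z
        have hinv' : ∀ z, g' (g'⁻¹ z) = z := fun z ↦ g'.apply_symm_apply z
        have hginv : ∀ z, g'⁻¹ z = affineReflection B.form a (g⁻¹ z) := fun z ↦ by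
          apply g'.injective
          rw [hinv', ← hgapp, hinv]
        have hga0 : affineForm B.form (g a) v = 0 := by
          have : affineForm B.form (-(g a)) v = 0 := by
            refine hv _ ⟨hneg, ?_⟩
            rw [map_neg, neg_neg, show g⁻¹ (g a) = a from g.symm_apply_apply a]
            exact hS.mem_pos a ha
          rw [← affinePairing_apply, map_neg, affinePairing_apply] at this
          linarith
        have hg'v : g' v = v := by
          refine ih l'.length (by omega) l' rfl hl' fun y hy ↦ hv y ⟨hy.1, ?_⟩
          have hy2 : -(g'⁻¹ y) ∈ affinePosRoots b := hy.2
          by_cases hya : -(g'⁻¹ y) = a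
          · exfalso
            rw [hginv] at hya
            have h1 : g⁻¹ y = a := by
              rw [← hss (g⁻¹ y), ← neg_neg (affineReflection B.form a (g⁻¹ y)), hya, map_neg,
                affineReflection_self ha0, neg_neg]
            rw [← h1, hinv] at hneg
            exact affine_neg_notMem H hy.1 hneg
          · have h1 := hS.smul_pos a ha _ hy2 hya
            change affineReflection B.form a (-(g'⁻¹ y)) ∈ _ at h1
            rwa [map_neg, hginv, hss] at h1
        have hsv : g⁻¹ v = affineReflection B.form a v := by
          apply g.injective
          rw [hinv, hgapp, hss, hg'v]
        have hav : affineForm B.form v a = 0 := by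
          rw [← hinv v, hg.form, hsv] at hga0
          rw [← affineForm_affineReflection H ha0, hss, affineReflection_self ha0] at hga0
          rw [← affinePairing_apply, map_neg, affinePairing_apply] at hga0
          rw [affineForm_symm H]
          linarith
        rw [hgapp, affineReflection_eq_self ha0 hav, hg'v]
  obtain ⟨l, hl, hprod⟩ := exists_word_of_mem_affineWeylGroup H hlong (inv_mem hx)
  have h1 := key _ l rfl hl (by rwa [← hprod, inv_inv])
  rw [← hprod] at h1
  rw [← h1]
  exact (x.apply_symm_apply v).trans h1.symm

/-- Every coset of the finite Weyl group in the affine one contains an element which is positive on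
the finite positive roots. -/
theorem exists_affineLift_mul_pos (H : Setting b B θ h)
    (hlong : ∀ β ∈ roots P, B.form β β ≤ B.form θ θ) {g : (M × ℚ × ℚ) ≃ₗ[ℚ] (M × ℚ × ℚ)}
    (hg : g ∈ affineWeylGroup b B.form θ) :
    ∃ v : P.weylGroup, ∀ x ∈ posRoots b, g (affineLift v (incl x)) ∈ affinePosRoots b := by
  have hS := isSimpleSystem_affine H hlong
  -- As long as some finite simple root is made negative, exchange strips its reflection off the
  -- right end; the stripped letters make up `v`.
  have key : ∀ n, ∀ l : List (M × ℚ × ℚ), l.length = n → (∀ a ∈ l, a ∈ affineSimpleRoots b θ) →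
      ∃ v : P.weylGroup, ∀ x ∈ simpleRoots b,
        (l.map (affineReflection B.form)).prod (affineLift v (incl x)) ∈ affinePosRoots b := by
    intro n
    induction n using Nat.strong_induction_on with
    | _ n ih =>
      intro l hn hl
      by_cases hpos : ∀ x ∈ simpleRoots b,
          (l.map (affineReflection B.form)).prod (incl x) ∈ affinePosRoots b
      · refine ⟨1, fun x hx ↦ ?_⟩
        rw [affineLift_incl, one_smul]
        exact hpos x hx
      · push Not at hpos
        obtain ⟨_, ⟨i, hi, rfl⟩, hneg⟩ := hpos
        have ha : incl (P.root i) ∈ affineSimpleRoots b θ := Or.inr ⟨_, ⟨i, hi, rfl⟩, rfl⟩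
        obtain ⟨l', hl', hlen, hprod⟩ := hS.exchange hl ha
          ((hS.pos_or_neg hl (hS.mem_pos _ ha)).resolve_left hneg)
        obtain ⟨v, hv⟩ := ih l'.length (by omega) l' rfl hl'
        refine ⟨weylGroup.ofIdx P i * v, fun x hx ↦ ?_⟩
        have hss := affineReflection_mul_self
          (affineForm_self_ne_zero H (affineSimpleRoots_subset H ha))
        rw [hprod, affineLift_mul, affineLift_ofIdx (B := B), LinearEquiv.mul_apply,
          LinearEquiv.mul_apply, ← LinearEquiv.mul_apply (affineReflection _ _), hss]
        exact hv x hx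
  obtain ⟨l, hl, rfl⟩ := exists_word_of_mem_affineWeylGroup H hlong hg
  obtain ⟨v, hv⟩ := key _ l rfl hl
  refine ⟨v, fun x hx ↦ ?_⟩
  set g := (l.map (affineReflection B.form)).prod
  have haut := isAffineAutomorphism_of_mem H hlong (mul_mem hg (affineLift_mem H v))
  have hroot := haut.mapsTo _ (mem_affineRoots_of_pos H ((incl_mem_affinePosRoots H).2 hx))
  refine (affine_pos_or_neg H hroot).resolve_right fun hneg ↦ ?_
  -- Positivity passes from simple to positive roots because the affine height of the image is
  -- linear in `x`.
  let f : M →ₗ[ℚ] ℚ := affineHeight h θ ∘ₗ (g * affineLift v).toLinearMap ∘ₗ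
    LinearMap.inl ℚ M (ℚ × ℚ)
  have hf : ∀ y, f y = affineHeight h θ (g (affineLift v (incl y))) := fun _ ↦ rfl
  obtain ⟨c, hc, hsum⟩ := H.exists_sum_of_pos hx
  have h1 : 0 ≤ f x := by
    rw [hsum, map_sum]
    refine Finset.sum_nonneg fun j hj ↦ ?_
    rw [map_zsmul, zsmul_eq_mul]
    refine mul_nonneg (by exact_mod_cast hc j) ?_
    rw [hf]
    exact (affineHeight_pos H (hv _ ⟨j, hj, rfl⟩)).le
  have h2 := affineHeight_pos H hneg
  rw [map_neg, LinearEquiv.mul_apply, ← hf] at h2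
  linarith

end Minuscule

/-! ### The least ideal with a given rootlet. -/

section Rootlets

variable {ι M N : Type*} [AddCommGroup M] [Module ℚ M] [AddCommGroup N] [Module ℚ N]
  {P : RootPairing ι ℚ M N} {b : P.Base} {B : P.InvariantForm} {θ : M} {h : M →ₗ[ℚ] ℚ}

/-- The ideal attached to the minuscule element `w s₀`, where `s₀` is the affine simple
reflection. -/
def minIdeal (b : P.Base) (θ : M) (w : P.weylGroup) : Set M :=
  {γ | γ = θ ∨ γ ∈ posRoots b ∧ θ - γ ∈ posRoots b ∧ -(w • (θ - γ)) ∈ posRoots b}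

/-- `w` takes `θ` to the positive root `μ` and the simple roots orthogonal to `θ` to positive
roots. -/
structure IsPositiveTo (b : P.Base) (B : P.InvariantForm) (θ μ : M) (w : P.weylGroup) : Prop where
  mem : μ ∈ posRoots b
  smul : w • θ = μ
  pos : ∀ a ∈ simpleRoots b, B.form θ a = 0 → w • a ∈ posRoots b

/-- `w` is a minuscule element corresponding to `I`, and `μ` is the rootlet read off from it. -/
def HasRootlet (b : P.Base) (B : P.InvariantForm) (θ μ : M) (I : Set M)
    (w : (M × ℚ × ℚ) ≃ₗ[ℚ] (M × ℚ × ℚ)) : Prop :=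
  I ⊆ posRoots b ∧ IsMinusculeFor b B.form θ I w ∧ w (alphaZero θ) + delta = incl μ

/-- For `γ ≠ θ`, `w` makes `θ - γ` negative, so `θ - γ` is not orthogonal to `θ`; its Cartan integer
against `θ` is then 1, and so is that of `γ`. -/
theorem minIdeal_form_pos [Finite ι] [P.IsCrystallographic] (H : Setting b B θ h)
    (hlong : ∀ β ∈ roots P, B.form β β ≤ B.form θ θ) {μ : M} {w : P.weylGroup}
    (hw : IsPositiveTo b B θ μ w) {γ : M} (hγ : γ ∈ minIdeal b θ w) :
    γ ∈ posRoots b ∧ 0 < B.form θ γ := by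
  rcases hγ with rfl | ⟨hγ, hγ', hneg⟩
  · exact ⟨H.theta_pos, H.self_pos H.theta_mem⟩
  · refine ⟨hγ, ?_⟩
    have hlev : 0 < B.form θ (θ - γ) := by
      refine (H.theta_nonneg hγ').lt_of_ne' fun h0 ↦ ?_
      exact H.neg_notMem (H.smul_pos_of_orthogonal hw.pos hγ' h0) hneg
    obtain ⟨h2, -⟩ := H.theta_sub hlong (H.root_of_pos hγ') (fun he ↦ by
      rw [sub_eq_self] at he
      exact H.zero_notMem (he ▸ H.root_of_pos hγ)) hlev
    rw [map_sub, LinearMap.sub_apply] at h2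
    rw [H.symm]
    linarith [H.self_pos H.theta_mem]

variable [Finite ι] [P.IsCrystallographic] [P.IsReduced]

theorem HasRootlet.mem_Ab (H : Setting b B θ h)
    (hlong : ∀ β ∈ roots P, B.form β β ≤ B.form θ θ) {μ : M} {I : Set M}
    {w : (M × ℚ × ℚ) ≃ₗ[ℚ] (M × ℚ × ℚ)} (hw : HasRootlet b B θ μ I w) (hI : I.Nonempty) :
    I ∈ Ab b B.form θ μ :=
  ⟨isAbelianIdeal_of_inversions H (isAffineAutomorphism_of_mem H hlong hw.2.1.1) hw.1 hw.2.1.2, hI,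
    w, hw.2.1, hw.2.2⟩

/-- The tool for enlarging ideals: since `w` takes `δ - η` to a simple root, `s_a w` gains exactly
that inversion, and `s_a` fixes `δ` and `μ`. -/
theorem HasRootlet.insert (H : Setting b B θ h)
    (hlong : ∀ β ∈ roots P, B.form β β ≤ B.form θ θ) {μ : M} {I : Set M}
    {w : (M × ℚ × ℚ) ≃ₗ[ℚ] (M × ℚ × ℚ)} (hw : HasRootlet b B θ μ I w) {η : M}
    (hη : η ∈ posRoots b) {a : M × ℚ × ℚ} (ha : a ∈ affineSimpleRoots b θ)
    (hwa : w (delta - incl η) = a) (haμ : affineForm B.form (incl μ) a = 0) :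
    HasRootlet b B θ μ (insert η I) (affineReflection B.form a * w) := by
  have har := affineSimpleRoots_subset H ha
  refine ⟨Set.insert_subset hη hw.1, ⟨mul_mem (affineReflection_mem H ha) hw.2.1.1, ?_⟩, ?_⟩
  · have := (isSimpleSystem_affine H hlong).inversions_mul ha
      (delta_sub_incl_mem H (H.root_of_pos hη)) hwa
    rw [Set.image_insert_eq, ← hw.2.1.2]
    exact this
  · rw [LinearEquiv.mul_apply, ← (isAffineAutomorphism_reflection H har).delta, ← map_add, hw.2.2,
      affineReflection_eq_self (affineForm_self_ne_zero H har) haμ]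

/-- Besides `α₀ = δ - θ`, an inversion of `w s₀` is `s₀ α` for a positive finite root `α` with `w α`
negative, as `w` preserves the `δ`-coefficient. Such an `α` has Cartan integer 1 against `θ`, so `s₀
α = δ - (θ - α)`. -/
theorem hasRootlet_minIdeal (H : Setting b B θ h)
    (hlong : ∀ β ∈ roots P, B.form β β ≤ B.form θ θ) {μ : M} {w : P.weylGroup}
    (hw : IsPositiveTo b B θ μ w) :
    HasRootlet b B θ μ (minIdeal b θ w)
      (affineLift w * affineReflection B.form (alphaZero θ)) := by
  have ha := alphaZero_mem (θ := θ) (b := b)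
  have har := affineSimpleRoots_subset H ha
  have ha0 := affineForm_self_ne_zero H har
  have hS := isSimpleSystem_affine H hlong
  have hss : ∀ z, affineReflection B.form (alphaZero θ)
      (affineReflection B.form (alphaZero θ) z) = z := fun z ↦
    LinearEquiv.congr_fun (affineReflection_mul_self ha0) z
  have hwα : affineLift w (alphaZero θ) = delta - incl μ := by
    rw [alphaZero_eq, delta_sub_incl, affineLift_apply, smul_neg, hw.smul]
  refine ⟨?_, ⟨mul_mem (affineLift_mem H w) (affineReflection_mem H ha), ?_⟩, ?_⟩
  · rintro γ (rfl | hγ)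
    exacts [H.theta_pos, hγ.1]
  · ext y
    constructor
    · rintro ⟨hy, hneg⟩
      rw [LinearEquiv.mul_apply] at hneg
      by_cases hyα : y = alphaZero θ
      · exact ⟨θ, Or.inl rfl, hyα.symm⟩
      · have hsy := hS.smul_pos _ ha y hy hyα
        change affineReflection B.form (alphaZero θ) y ∈ _ at hsy
        obtain ⟨α, hα, k, hk, hpos⟩ := (mem_affinePosRoots H).1 hsy
        rw [hk] at hneg
        have hn : -affineLift w (α, (k : ℚ), 0) = (-(w • α), ((-k : ℤ) : ℚ), 0) := by
          simp [affineLift_apply]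
        rw [hn, mk_mem_affinePosRoots H] at hneg
        obtain ⟨rfl, hwneg⟩ : k = 0 ∧ -(w • α) ∈ posRoots b := by
          rcases hneg.2 with h1 | h1
          · omega
          · exact ⟨by omega, h1.2⟩
        have hαp : α ∈ posRoots b := by simpa using hpos
        have hαθ : α ≠ θ := by
          rintro rfl
          rw [hw.smul] at hwneg
          exact H.neg_notMem hw.mem hwneg
        have hlev : 0 < B.form θ α := by
          refine (H.theta_nonneg hαp).lt_of_ne' fun h0 ↦ ?_
          exact H.neg_notMem (H.smul_pos_of_orthogonal hw.pos hαp h0) hwneg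
        obtain ⟨h2, h3⟩ := H.theta_sub hlong hα hαθ hlev
        refine ⟨θ - α, Or.inr ⟨h3, by rwa [sub_sub_cancel], by rwa [sub_sub_cancel]⟩, ?_⟩
        rw [← hss y, hk, Int.cast_zero, ← incl_eq]
        have := affineReflection_alphaZero_incl_theta_sub H (γ := θ - α) (by
          rw [map_sub, LinearMap.sub_apply]; linarith)
        rw [sub_sub_cancel] at this
        exact this.symm
    · rintro ⟨γ, rfl | ⟨hγ, hγ', hwγ⟩, rfl⟩
      · refine ⟨delta_sub_incl_mem H H.theta_mem, ?_⟩
        change -((affineLift w * affineReflection B.form (alphaZero γ)) (alphaZero γ)) ∈ _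
        rw [LinearEquiv.mul_apply, affineReflection_self ha0, map_neg, neg_neg, hwα]
        exact delta_sub_incl_mem H (H.root_of_pos hw.mem)
      · refine ⟨delta_sub_incl_mem H (H.root_of_pos hγ), ?_⟩
        have hne : γ ≠ θ := by
          rintro rfl
          rw [sub_self] at hγ'
          exact H.zero_notMem (H.root_of_pos hγ')
        have hlev : 0 < B.form θ (θ - γ) := by
          refine (H.theta_nonneg hγ').lt_of_ne' fun h0 ↦ ?_
          exact H.neg_notMem (H.smul_pos_of_orthogonal hw.pos hγ' h0) hwγ
        obtain ⟨h2, -⟩ := H.theta_sub hlong (H.root_of_pos hγ') (fun he ↦ by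
          rw [sub_eq_self] at he
          exact H.zero_notMem (he ▸ H.root_of_pos hγ)) hlev
        rw [map_sub, LinearMap.sub_apply] at h2
        change -((affineLift w * affineReflection B.form (alphaZero θ)) (delta - incl γ)) ∈ _
        rw [LinearEquiv.mul_apply, ← affineReflection_alphaZero_incl_theta_sub H (γ := γ)
          (by linarith), hss, affineLift_incl]
        have := (incl_mem_affinePosRoots H).2 hwγ
        simpa [incl_eq] using this
  · rw [LinearEquiv.mul_apply, affineReflection_self ha0, map_neg, hwα]
    abel

/-- The members of an Abelian ideal with rootlet `μ` that are not orthogonal to `θ` are determined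
by `μ`. -/
theorem mem_iff_mem_minIdeal (H : Setting b B θ h)
    (hlong : ∀ β ∈ roots P, B.form β β ≤ B.form θ θ) {μ : M} {w₀ : P.weylGroup}
    (hw₀ : IsPositiveTo b B θ μ w₀) {J : Set M} (hJ : J ∈ Ab b B.form θ μ) {γ : M}
    (hγ : γ ∈ posRoots b) (hγθ : 0 < B.form θ γ) : γ ∈ J ↔ γ ∈ minIdeal b θ w₀ := by
  obtain ⟨hab, -, w, ⟨hwW, hinv⟩, hwα⟩ := hJ
  have ha := alphaZero_mem (θ := θ) (b := b)
  have har := affineSimpleRoots_subset H ha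
  have ha0 := affineForm_self_ne_zero H har
  have hS := isSimpleSystem_affine H hlong
  set s := affineReflection B.form (alphaZero θ) with hs
  have hss : ∀ z, s (s z) = z := fun z ↦
    LinearEquiv.congr_fun (affineReflection_mul_self ha0) z
  have hsW := affineReflection_mem H ha
  have hwaut := isAffineAutomorphism_of_mem H hlong hwW
  have hwα' : w (alphaZero θ) = -(delta - incl μ) := by
    rw [neg_sub]
    exact eq_sub_of_add_eq hwα
  have hwsθ : w (s (incl θ)) = incl μ := by
    have : s (incl θ) = alphaZero θ + delta := by
      rw [hs, incl_eq, affineReflection_alphaZero H (n := 2) rfl, alphaZero_eq]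
      ext
      · simp [delta, two_smul]
      · norm_num [delta]
      · simp [delta]
    rw [this, map_add, hwaut.delta, hwα]
  have hmemJ : ∀ {γ}, γ ∈ posRoots b → (γ ∈ J ↔ -(w (delta - incl γ)) ∈ affinePosRoots b) := by
    intro γ hγ
    constructor
    · intro h1
      exact (hinv.ge ⟨γ, h1, rfl⟩ : delta - incl γ ∈ inversions b w).2
    · intro h1
      have : delta - incl γ ∈ inversions b w := ⟨delta_sub_incl_mem H (H.root_of_pos hγ), h1⟩
      rw [hinv] at this
      obtain ⟨γ', hγ', he⟩ := this
      rwa [← delta_sub_incl_injective he]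
  have hfin : ∀ {x}, x ∈ posRoots b → -(w (incl x)) ∉ affinePosRoots b := by
    intro x hx h1
    have : incl x ∈ inversions b w := ⟨(incl_mem_affinePosRoots H).2 hx, h1⟩
    rw [hinv] at this
    obtain ⟨γ', -, he⟩ := this
    exact incl_ne_delta_sub _ _ he.symm
  -- The finite factor: `x = w s v` is positive on `Δ⁺`, and `v⁻¹` will turn out to be `w₀`.
  obtain ⟨v, hv⟩ := exists_affineLift_mul_pos H hlong (mul_mem hwW hsW)
  simp only [LinearEquiv.mul_apply] at hv
  set x := w * s * affineLift v with hx
  have hxapp : ∀ z, x z = w (s (affineLift v z)) := fun _ ↦ rfl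
  have hfix : x (incl (v⁻¹ • θ)) = incl (v⁻¹ • θ) := by
    refine apply_eq_self_of_inversions_orthogonal H hlong
      (mul_mem (mul_mem hwW hsW) (affineLift_mem H v)) ?_
    rintro y ⟨hy, hneg⟩
    change -(x y) ∈ _ at hneg
    obtain ⟨α, hα, k, rfl, hk⟩ := (mem_affinePosRoots H).1 hy
    have hk1 : 1 ≤ k := by
      refine hk.resolve_right ?_
      rintro ⟨rfl, hαp⟩
      rw [Int.cast_zero, ← incl_eq] at hneg
      exact affine_neg_notMem H (hv α hαp) hneg
    have hd : affineLift v (α, (k : ℚ), 0) = (v • α, (k : ℚ), 0) := rfl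
    have hdp : (v • α, (k : ℚ), (0 : ℚ)) ∈ affinePosRoots b :=
      (mk_mem_affinePosRoots H).2 ⟨smul_mem_roots v hα, Or.inl hk1⟩
    rw [hxapp, hd] at hneg
    have hdα : (v • α, (k : ℚ), (0 : ℚ)) ≠ alphaZero θ := by
      intro he
      rw [he, hs, affineReflection_self ha0, map_neg, hwα', neg_neg] at hneg
      exact affine_neg_notMem H (delta_sub_incl_mem H (H.root_of_pos hw₀.mem)) hneg
    -- An inversion of `x` yields an inversion `δ - γ` of `w`. Applying `s` to it gives
    -- `δ`-coefficient `1 - n`, where `n ≥ 0` is the Cartan integer of `γ` against `θ`; this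
    -- coefficient is at least 1, so `n = 0`.
    have hsd : s (v • α, (k : ℚ), (0 : ℚ)) ∈ inversions b w :=
      ⟨hS.smul_pos _ ha _ hdp hdα, hneg⟩
    rw [hinv] at hsd
    obtain ⟨γ, hγJ, hγ⟩ := hsd
    have hγp := hab.subset_posRoots hγJ
    obtain ⟨n, hn, -⟩ := H.exists_pairing (H.root_of_pos hγp) H.theta_mem
    have h1 : (v • α, (k : ℚ), (0 : ℚ)) = (-γ - (-n : ℚ) • θ, (1 : ℚ) + -n, (0 : ℚ)) := by
      rw [← hss (v • α, (k : ℚ), (0 : ℚ)), ← hγ]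
      change s (delta - incl γ) = _
      rw [delta_sub_incl, hs, affineReflection_alphaZero H (n := -n)
        (by simp only [map_neg, LinearMap.neg_apply]; linarith)]
    simp only [Prod.mk.injEq, and_true] at h1
    have h2 : k = 1 - n := by
      have : (k : ℚ) = ((1 - n : ℤ) : ℚ) := by rw [h1.2]; push_cast; ring
      exact_mod_cast this
    have h3 : 0 ≤ n := by
      have h4 := H.theta_nonneg hγp
      rw [H.symm] at h4
      have h5 : 0 ≤ (n : ℚ) * B.form θ θ := by linarith
      exact_mod_cast nonneg_of_mul_nonneg_left h5 (H.self_pos H.theta_mem)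
    obtain rfl : n = 0 := by omega
    have h4 : B.form γ θ = 0 := by simpa using hn
    have h5 : B.form α (v⁻¹ • θ) = 0 := by
      rw [H.symm, weyl_form_inv, h1.1, H.symm]
      simp [h4]
    simp [affineForm, incl_eq, h5]
  have hvθ : v⁻¹ • θ = μ := by
    rw [hxapp, affineLift_incl, smul_inv_smul, hwsθ] at hfix
    exact (incl_injective hfix).symm
  -- If `v⁻¹ a` were negative for a simple `a` orthogonal to `θ`, positivity of `x` would make `w a`
  -- negative, but `w` has no finite inversions.
  have hvw : v⁻¹ = w₀ := by
    refine H.eq_of_smul_theta_eq (hvθ.trans hw₀.smul.symm) (fun a haS haθ ↦ ?_) hw₀.pos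
    have hap := (H.simple_mem haS).1
    refine (H.pos_or_neg (smul_mem_roots _ (H.root_of_pos hap))).resolve_right fun hneg ↦ ?_
    have h1 := hv _ hneg
    rw [affineLift_incl, smul_neg, smul_inv_smul, incl_eq,
      affineReflection_alphaZero H (n := 0) (by simp [H.symm a, haθ])] at h1
    refine hfin hap ?_
    rw [← map_neg]
    simpa [incl_eq] using h1
  by_cases hne : γ = θ
  · subst hne
    rw [hmemJ hγ]
    refine ⟨fun _ ↦ Or.inl rfl, fun _ ↦ ?_⟩
    change -(w (alphaZero γ)) ∈ _
    rw [hwα', neg_neg]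
    exact delta_sub_incl_mem H (H.root_of_pos hw₀.mem)
  · obtain ⟨h2, h3⟩ := H.theta_sub hlong (H.root_of_pos hγ) hne hγθ
    -- Since `x` preserves the sign of finite roots, membership of `γ` depends only on the sign of
    -- `w₀ (θ - γ)`.
    have h4 : w (delta - incl γ) = x (incl (w₀ • (θ - γ))) := by
      rw [hxapp, affineLift_incl, ← hvw, smul_inv_smul, hs,
        affineReflection_alphaZero_incl_theta_sub H h2]
    rw [hmemJ hγ, h4]
    constructor
    · intro h5
      refine Or.inr ⟨hγ, h3, ?_⟩
      refine (H.pos_or_neg (smul_mem_roots _ (H.root_of_pos h3))).resolve_left fun h6 ↦ ?_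
      exact affine_neg_notMem H (hv _ h6) h5
    · rintro (h5 | ⟨-, -, h5⟩)
      · exact absurd h5 hne
      · have := hv _ h5
        have h6 : -(x (incl (w₀ • (θ - γ)))) = x (incl (-(w₀ • (θ - γ)))) := by
          rw [← map_neg]
          simp [incl_eq]
        rw [h6]
        exact this

theorem minIdeal_subset (H : Setting b B θ h)
    (hlong : ∀ β ∈ roots P, B.form β β ≤ B.form θ θ) {μ : M} {w : P.weylGroup}
    (hw : IsPositiveTo b B θ μ w) {J : Set M} (hJ : J ∈ Ab b B.form θ μ) :
    minIdeal b θ w ⊆ J := fun γ hγ ↦ by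
  obtain ⟨h1, h2⟩ := minIdeal_form_pos H hlong hw hγ
  exact (mem_iff_mem_minIdeal H hlong hw hJ h1 h2).2 hγ

end Rootlets

/-! ### The part of an ideal orthogonal to `θ`. -/

section Classification

variable {ι M N : Type*} [AddCommGroup M] [Module ℚ M] [AddCommGroup N] [Module ℚ N]
  {P : RootPairing ι ℚ M N} {b : P.Base} {B : P.InvariantForm} {θ : M} {h : M →ₗ[ℚ] ℚ}

/-- The images under `w` of the members of `J` that are orthogonal to `θ`. -/
def orthogonalPart (B : P.InvariantForm) (μ : M) (w : P.weylGroup) (J : Set M) : Set M :=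
  {β | w⁻¹ • β ∈ J ∧ B.form μ β = 0}

theorem theta_form_inv_smul {μ : M} {w : P.weylGroup} (hw : w • θ = μ) (x : M) :
    B.form θ (w⁻¹ • x) = B.form μ x := by
  rw [← weyl_form B w, hw, smul_inv_smul]

theorem simple_ne_theta {μ : M} {w : P.weylGroup} (H : Setting b B θ h) (hw : IsPositiveTo b B θ μ w)
    (hμθ : B.form μ θ = 0) {a : M} (ha : a ∈ simpleRoots b) : a ≠ θ := by
  rintro rfl
  have h1 := (H.height_le (H.root_of_pos hw.mem)).2 (by
    rw [(H.simple_mem ha).2]; exact H.one_le_height hw.mem)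
  rw [h1] at hμθ
  exact (H.self_pos H.theta_mem).ne' hμθ

section

variable [Finite ι] [P.IsCrystallographic]

theorem IsPositiveTo.inv_smul_pos (H : Setting b B θ h) {μ : M} {w : P.weylGroup}
    (hw : IsPositiveTo b B θ μ w) {x : M} (hx : x ∈ posRoots b) (hxμ : B.form μ x = 0) :
    w⁻¹ • x ∈ posRoots b := by
  refine H.pos_of_smul_pos hw.pos (smul_mem_roots _ (H.root_of_pos hx)) ?_ ?_
  · rw [theta_form_inv_smul hw.smul, hxμ]
  · rwa [smul_inv_smul]

variable {μ : M} {w : P.weylGroup} {J : Set M} {β : M}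

theorem mem_posRoots_of_mem_orthogonalPart (H : Setting b B θ h) (hw : IsPositiveTo b B θ μ w)
    (hJ : J ∈ Ab b B.form θ μ) (hβ : β ∈ orthogonalPart B μ w J) : β ∈ posRoots b := by
  have := H.smul_pos_of_orthogonal hw.pos (hJ.1.subset_posRoots hβ.1)
    (by rw [theta_form_inv_smul hw.smul, hβ.2])
  rwa [smul_inv_smul] at this

variable [P.IsReduced]

/-- The root `w⁻¹(μ - κ)` is the sum of `w⁻¹ β ∈ J` and `w⁻¹(μ - κ - β)`, which is positive because
it pairs positively with `θ`; so it lies in `J`. It also pairs positively with `θ`, hence lies in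
`minIdeal`, whose sign condition concerns `w(θ - w⁻¹(μ - κ)) = κ`. -/
theorem neg_of_add_mem (H : Setting b B θ h) (hlong : ∀ β ∈ roots P, B.form β β ≤ B.form θ θ)
    (hw : IsPositiveTo b B θ μ w) (hJ : J ∈ Ab b B.form θ μ) (hβ : β ∈ orthogonalPart B μ w J)
    {κ : M} (hκ : κ ∈ roots P) (hκμ : 2 * B.form μ κ = B.form μ μ) (hsum : κ + β ∈ roots P) :
    -κ ∈ posRoots b := by
  have hμ := H.root_of_pos hw.mem
  have hμμ := H.self_pos hμ
  have hκ₁ : μ - κ ∈ roots P := H.sub_mem hμ hκ (by linarith) (by rintro rfl; linarith)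
  have hsumμ : 2 * B.form μ (κ + β) = B.form μ μ := by rw [map_add, hβ.2, add_zero, hκμ]
  have hκ₂ : μ - (κ + β) ∈ roots P :=
    H.sub_mem hμ hsum (by linarith) fun he ↦ by rw [← he] at hsumμ; linarith
  have hlev : ∀ y, 2 * B.form μ y = B.form μ μ → 0 < B.form θ (w⁻¹ • y) := fun y hy ↦ by
    rw [theta_form_inv_smul hw.smul]; linarith
  have hν := H.pos_of_theta (smul_mem_roots w⁻¹ hκ₂) (hlev _ (by
    rw [map_sub]; linarith))
  have hadd : w⁻¹ • β + w⁻¹ • (μ - (κ + β)) = w⁻¹ • (μ - κ) := by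
    rw [← smul_add]; congr 1; abel
  have hroot : w⁻¹ • (μ - κ) ∈ roots P := smul_mem_roots _ hκ₁
  have hmem := hJ.1.add_mem _ hβ.1 _ hν (by rwa [hadd])
  rw [hadd] at hmem
  have hμκ : 2 * B.form μ (μ - κ) = B.form μ μ := by rw [map_sub]; linarith
  rw [mem_iff_mem_minIdeal H hlong hw hJ (hJ.1.subset_posRoots hmem) (hlev _ hμκ)] at hmem
  have hθ : θ = w⁻¹ • μ := by rw [← hw.smul, inv_smul_smul]
  rcases hmem with he | ⟨-, -, hneg⟩
  · exfalso
    rw [hθ] at he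
    have := MulAction.injective _ he
    rw [this] at hμκ
    linarith
  · rwa [hθ, ← smul_sub, sub_sub_cancel, smul_inv_smul] at hneg

theorem add_notMem_of_form_ne_zero (H : Setting b B θ h)
    (hlong : ∀ β ∈ roots P, B.form β β ≤ B.form θ θ) (hμlong : B.form μ μ = B.form θ θ)
    (hw : IsPositiveTo b B θ μ w) (hJ : J ∈ Ab b B.form θ μ) (hβ : β ∈ orthogonalPart B μ w J)
    {κ : M} (hκ : κ ∈ posRoots b) (hκμ : B.form μ κ ≠ 0) : κ + β ∉ roots P := by
  intro hsum
  have hμ := H.root_of_pos hw.mem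
  have hμμ := H.self_pos hμ
  have hκr := H.root_of_pos hκ
  have hβp := mem_posRoots_of_mem_orthogonalPart H hw hJ hβ
  -- The root `μ + β` would be longer than `μ`, as `β` is orthogonal to `μ`.
  have hne : κ ≠ μ := by
    rintro rfl
    have h1 := hlong _ hsum
    have h2 := H.self_pos (H.root_of_pos hβp)
    have h3 := H.symm κ β
    have h4 := hβ.2
    simp only [map_add, LinearMap.add_apply] at h1
    linarith
  have hne' : -κ ≠ μ := by
    rintro rfl
    exact H.neg_notMem hκ hw.mem
  obtain ⟨n, hn, -⟩ := H.exists_pairing hκr hμ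
  have h1 := H.pairing_le_one (by rw [hμlong]; exact hlong _ hκr) hμ hne hn
  have h2 := H.pairing_le_one (x := -κ) (n := -n)
    (by rw [hμlong]; simpa using hlong _ hκr) hμ hne'
    (by rw [map_neg, LinearMap.neg_apply]; push_cast; linarith)
  rw [H.symm] at hn
  have h3 : n ≠ 0 := by
    rintro rfl
    apply hκμ
    rw [Int.cast_zero, zero_mul] at hn
    linarith
  -- For Cartan integer 1, `neg_of_add_mem` contradicts the positivity of `κ`. For -1 it is applied
  -- to the positive root `κ + μ`, whose Cartan integer is 1.
  obtain rfl | rfl : n = 1 ∨ n = -1 := by omega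
  · rw [Int.cast_one, one_mul] at hn
    exact H.neg_notMem hκ (neg_of_add_mem H hlong hw hJ hβ hκr hn hsum)
  · push_cast at hn
    have h4 : κ + μ ∈ roots P := H.add_mem hκr hμ (by rw [H.symm]; linarith) fun he ↦
      H.neg_notMem hw.mem (he ▸ hκ)
    have h5 : κ + μ + β ∈ roots P := by
      have := H.add_mem hsum hμ (by
        rw [H.symm, map_add, hβ.2]; linarith) fun he ↦
          H.neg_notMem hw.mem (he ▸ H.add_pos hκ hβp hsum)
      rwa [add_right_comm] at this
    exact H.neg_notMem (H.add_pos hκ hw.mem h4) (neg_of_add_mem H hlong hw hJ hβ h4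
      (by rw [map_add]; linarith) h5)

variable [P.IsIrreducible]

theorem exists_simple_add_mem (H : Setting b B θ h)
    (hlong : ∀ β ∈ roots P, B.form β β ≤ B.form θ θ) (hμlong : B.form μ μ = B.form θ θ)
    (hw : IsPositiveTo b B θ μ w) (hJ : J ∈ Ab b B.form θ μ) (hβ : β ∈ orthogonalPart B μ w J)
    (hne : β ≠ θ) :
    ∃ a ∈ simpleRoots b, B.form μ a = 0 ∧ β + a ∈ orthogonalPart B μ w J := by
  have hβp := mem_posRoots_of_mem_orthogonalPart H hw hJ hβ
  obtain ⟨a, ha, hsum⟩ := H.exists_simple_add hβp hne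
  have hap := (H.simple_mem ha).1
  have haμ : B.form μ a = 0 := by
    by_contra hc
    exact add_notMem_of_form_ne_zero H hlong hμlong hw hJ hβ hap hc (by rwa [add_comm])
  refine ⟨a, ha, haμ, ?_, by rw [map_add, hβ.2, haμ, add_zero]⟩
  rw [smul_add]
  refine hJ.1.add_mem _ hβ.1 _ (hw.inv_smul_pos H hap haμ) ?_
  rw [← smul_add]
  exact smul_mem_roots _ hsum

/-- Climbing from `β` by simple roots orthogonal to `μ` ends at `θ`; the last step of the climb
supplies `θ - a`. -/
theorem theta_mem_orthogonalPart (H : Setting b B θ h)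
    (hlong : ∀ β ∈ roots P, B.form β β ≤ B.form θ θ) (hμlong : B.form μ μ = B.form θ θ)
    (hw : IsPositiveTo b B θ μ w) (hJ : J ∈ Ab b B.form θ μ) (hβ : β ∈ orthogonalPart B μ w J) :
    θ ∈ orthogonalPart B μ w J ∧
      (β = θ ∨ ∃ a ∈ simpleRoots b, B.form μ a = 0 ∧ θ - a ∈ orthogonalPart B μ w J) := by
  have key : ∀ n : ℕ, ∀ β ∈ orthogonalPart B μ w J, h θ - h β ≤ n →
      θ ∈ orthogonalPart B μ w J ∧
      (β = θ ∨ ∃ a ∈ simpleRoots b, B.form μ a = 0 ∧ θ - a ∈ orthogonalPart B μ w J) := by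
    intro n
    induction n with
    | zero =>
      intro β hβ hle
      have hβp := mem_posRoots_of_mem_orthogonalPart H hw hJ hβ
      have := (H.height_le (H.root_of_pos hβp)).2 (by
        rw [Nat.cast_zero] at hle; linarith)
      exact ⟨this ▸ hβ, Or.inl this⟩
    | succ n ih =>
      intro β hβ hle
      by_cases hne : β = θ
      · exact ⟨hne ▸ hβ, Or.inl hne⟩
      · obtain ⟨a, ha, haμ, hmem⟩ := exists_simple_add_mem H hlong hμlong hw hJ hβ hne
        obtain ⟨h1, h2⟩ := ih _ hmem (by
          rw [map_add, (H.simple_mem ha).2]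
          push_cast at hle
          linarith)
        refine ⟨h1, Or.inr ?_⟩
        rcases h2 with h2 | h2
        · exact ⟨a, ha, haμ, by rwa [← h2, add_sub_cancel_right]⟩
        · exact h2
  obtain ⟨n, hn⟩ := exists_nat_ge (h θ - h β)
  exact key n β hβ hn

theorem eq_or_of_mem_Ab (H : Setting b B θ h)
    (hlong : ∀ β ∈ roots P, B.form β β ≤ B.form θ θ) (hμlong : B.form μ μ = B.form θ θ)
    (hw : IsPositiveTo b B θ μ w) (hJ : J ∈ Ab b B.form θ μ) :
    J = minIdeal b θ w ∨ w⁻¹ • θ ∈ J ∧ (J = minIdeal b θ w ∪ {w⁻¹ • θ} ∨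
      ∃ a ∈ simpleRoots b, 0 < B.form a θ ∧ B.form a μ = 0 ∧ w⁻¹ • (θ - a) ∈ J) := by
  have hsub := minIdeal_subset H hlong hw hJ
  have hpart : ∀ γ ∈ J, γ ∉ minIdeal b θ w → w • γ ∈ orthogonalPart B μ w J := by
    intro γ hγ hγm
    have hγp := hJ.1.subset_posRoots hγ
    refine ⟨by rwa [inv_smul_smul], ?_⟩
    rw [← hw.smul, weyl_form]
    by_contra hc
    exact hγm ((mem_iff_mem_minIdeal H hlong hw hJ hγp
      ((H.theta_nonneg hγp).lt_of_ne' hc)).1 hγ)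
  by_cases h1 : J = minIdeal b θ w
  · exact Or.inl h1
  obtain ⟨γ, hγ, hγm⟩ := Set.exists_of_ssubset (hsub.ssubset_of_ne (Ne.symm h1))
  have hη := (theta_mem_orthogonalPart H hlong hμlong hw hJ (hpart γ hγ hγm)).1.1
  refine Or.inr ⟨hη, ?_⟩
  by_cases h2 : J = minIdeal b θ w ∪ {w⁻¹ • θ}
  · exact Or.inl h2
  have hsub' : minIdeal b θ w ∪ {w⁻¹ • θ} ⊆ J :=
    Set.union_subset hsub (Set.singleton_subset_iff.2 hη)
  obtain ⟨γ, hγ, hγm⟩ := Set.exists_of_ssubset (hsub'.ssubset_of_ne (Ne.symm h2))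
  rw [Set.mem_union, Set.mem_singleton_iff, not_or] at hγm
  rcases (theta_mem_orthogonalPart H hlong hμlong hw hJ (hpart γ hγ hγm.1)).2 with h3 | h3
  · exact absurd (by rw [← h3, inv_smul_smul]) hγm.2
  · obtain ⟨a, ha, haμ, hmem⟩ := h3
    refine Or.inr ⟨a, ha, ?_, by rw [H.symm, haμ], hmem.1⟩
    -- Since `θ - a` is a root, it is no longer than `θ`, which forces `2(a, θ) ≥ (a, a) > 0`.
    have hr := H.root_of_pos (mem_posRoots_of_mem_orthogonalPart H hw hJ hmem)
    have h4 := hlong _ hr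
    have h5 := H.self_pos (H.root_of_pos (H.simple_mem ha).1)
    have h6 := H.symm θ a
    simp only [map_sub, LinearMap.sub_apply] at h4
    linarith

end

variable [Finite ι] [P.IsCrystallographic] [P.IsReduced] {μ : M} {w : P.weylGroup}

/-- As `w⁻¹ θ` is orthogonal to `θ`, `s₀` fixes `δ - w⁻¹ θ`, and `w` then takes it to the simple
root `α₀`, which is orthogonal to `μ`. -/
theorem hasRootlet_insert_theta (H : Setting b B θ h)
    (hlong : ∀ β ∈ roots P, B.form β β ≤ B.form θ θ) (hw : IsPositiveTo b B θ μ w)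
    (hμθ : B.form μ θ = 0) :
    HasRootlet b B θ μ (insert (w⁻¹ • θ) (minIdeal b θ w))
      (affineReflection B.form (alphaZero θ) *
        (affineLift w * affineReflection B.form (alphaZero θ))) := by
  refine (hasRootlet_minIdeal H hlong hw).insert H hlong (hw.inv_smul_pos H H.theta_pos hμθ)
    alphaZero_mem ?_ ?_
  · rw [LinearEquiv.mul_apply, affineReflection_alphaZero_delta_sub H (by
      rw [H.symm, theta_form_inv_smul hw.smul, hμθ])]
    rw [delta_sub_incl, affineLift_apply, alphaZero_eq, smul_neg, smul_inv_smul]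
  · simp [affineForm, incl_eq, alphaZero_eq, hμθ]

/-- The first two factors take `δ - w⁻¹(θ - a)` to `δ - (θ - a) = s₀ a`, and the next `s₀` takes
this to the simple root `a`, which is orthogonal to `μ`. -/
theorem hasRootlet_insert_theta_sub (H : Setting b B θ h)
    (hlong : ∀ β ∈ roots P, B.form β β ≤ B.form θ θ) (hw : IsPositiveTo b B θ μ w)
    (hμθ : B.form μ θ = 0) {a : M} (ha : a ∈ simpleRoots b) (haθ : 0 < B.form a θ)
    (haμ : B.form a μ = 0) :
    HasRootlet b B θ μ (insert (w⁻¹ • (θ - a)) (insert (w⁻¹ • θ) (minIdeal b θ w)))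
      (affineReflection B.form (incl a) * (affineReflection B.form (alphaZero θ) *
        (affineLift w * affineReflection B.form (alphaZero θ)))) := by
  have har := H.root_of_pos (H.simple_mem ha).1
  obtain ⟨h1, h2⟩ := H.theta_sub hlong har (simple_ne_theta H hw hμθ ha) (by rwa [H.symm])
  have hort : B.form μ (θ - a) = 0 := by rw [map_sub, hμθ, H.symm, haμ, sub_zero]
  refine (hasRootlet_insert_theta H hlong hw hμθ).insert H hlong (hw.inv_smul_pos H h2 hort)
    (Or.inr ⟨a, ha, rfl⟩) ?_ ?_
  · have h3 := affineReflection_alphaZero_incl_theta_sub H (γ := θ - a) (by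
      rw [map_sub, LinearMap.sub_apply]; linarith)
    rw [sub_sub_cancel] at h3
    have h4 : affineLift w (delta - incl (w⁻¹ • (θ - a))) = delta - incl (θ - a) := by
      rw [delta_sub_incl, delta_sub_incl, affineLift_apply, smul_neg, smul_inv_smul]
    rw [LinearEquiv.mul_apply, LinearEquiv.mul_apply, affineReflection_alphaZero_delta_sub H (by
      rw [H.symm, theta_form_inv_smul hw.smul, hort]), h4, ← h3]
    exact LinearEquiv.congr_fun (affineReflection_mul_self (affineForm_self_ne_zero H
      (affineSimpleRoots_subset H alphaZero_mem))) _
  · simp [affineForm, incl_eq, H.symm μ, haμ]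

end Classification

end AbelianIdeals

end

/-! ### The bottom of the poset of ideals with rootlet `μ`. -/

theorem mainTheorem9 {ι M N : Type*} [Finite ι] [AddCommGroup M] [Module ℚ M]
    [AddCommGroup N] [Module ℚ N] (P : RootPairing ι ℚ M N)
    [P.IsCrystallographic] [P.IsReduced] [P.IsIrreducible] (b : P.Base)
    (B : P.InvariantForm) (hB : ∀ x : M, x ≠ 0 → 0 < B.form x x)
    (θ : M) (hθ : AbelianIdeals.IsHighestRoot b θ)
    (μ : M) (hμ : μ ∈ AbelianIdeals.longPosRoots b B.form) (hμθ : B.form μ θ = 0) :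
    (2 < (AbelianIdeals.Ab b B.form θ μ).encard ↔
      ∃ α ∈ AbelianIdeals.simpleRoots b, 0 < B.form α θ ∧ B.form α μ = 0) ∧
    ∃ (Imin : Set M) (w : P.weylGroup),
      IsLeast (AbelianIdeals.Ab b B.form θ μ) Imin ∧
      AbelianIdeals.IsShortestTo b θ μ w ∧
      (∀ u : P.weylGroup, AbelianIdeals.IsShortestTo b θ μ u → u = w) ∧
      IsLeast (AbelianIdeals.Ab b B.form θ μ \ {Imin}) (Imin ∪ {w⁻¹ • θ}) ∧
      ∀ J : Set M,
        Minimal (· ∈ AbelianIdeals.Ab b B.form θ μ \ {Imin, Imin ∪ {w⁻¹ • θ}}) J ↔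
          ∃ α ∈ AbelianIdeals.simpleRoots b, 0 < B.form α θ ∧ B.form α μ = 0 ∧
            J = Imin ∪ {w⁻¹ • θ, w⁻¹ • (θ - α)} := by
  open AbelianIdeals in
  obtain ⟨i, -⟩ := hθ.1
  have : Nonempty ι := ⟨i⟩
  obtain ⟨h, hh⟩ := exists_height_functional b
  have H : Setting b B θ h := ⟨hB, hθ, hh⟩
  have hex := H.exists_smul_theta_eq hμ
  -- The root `θ` is long because it lies in the Weyl orbit of the long root `μ`.
  have hμlong : B.form μ μ = B.form θ θ := by
    obtain ⟨u, rfl⟩ := hex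
    exact weyl_form B u θ θ
  have hlong : ∀ β ∈ roots P, B.form β β ≤ B.form θ θ := fun β hβ ↦ hμlong ▸ hμ.2 β hβ
  obtain ⟨w, hwS⟩ := H.exists_isShortestTo hex
  have hpos : ∀ u : P.weylGroup, IsShortestTo b θ μ u → IsPositiveTo b B θ μ u := fun u hu ↦
    ⟨hμ.1, hu.1, fun a ha haθ ↦ H.smul_pos_of_isShortestTo hu ha haθ⟩
  have hw := hpos w hwS
  set Imin := minIdeal b θ w with hImin
  set η := w⁻¹ • θ with hη
  have hηθ : B.form θ η = 0 := by rw [hη, theta_form_inv_smul hw.smul, hμθ]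
  have hImin_mem : Imin ∈ Ab b B.form θ μ :=
    (hasRootlet_minIdeal H hlong hw).mem_Ab H hlong ⟨θ, Or.inl rfl⟩
  have hleast : ∀ J ∈ Ab b B.form θ μ, Imin ⊆ J := fun J hJ ↦ minIdeal_subset H hlong hw hJ
  have hnot : ∀ γ, B.form θ γ = 0 → γ ∉ Imin := fun γ h0 h1 ↦
    (minIdeal_form_pos H hlong hw h1).2.ne' h0
  have hI' : Imin ∪ {η} ∈ Ab b B.form θ μ := by
    rw [Set.union_singleton]
    exact (hasRootlet_insert_theta H hlong hw hμθ).mem_Ab H hlong ⟨_, Set.mem_insert _ _⟩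
  have hI'ne : Imin ∪ {η} ≠ Imin := fun he ↦ hnot η hηθ (he ▸ Or.inr rfl)
  have hI'' : ∀ α ∈ simpleRoots b, 0 < B.form α θ → B.form α μ = 0 →
      Imin ∪ {η, w⁻¹ • (θ - α)} ∈ Ab b B.form θ μ := by
    intro α hα hαθ hαμ
    have := (hasRootlet_insert_theta_sub H hlong hw hμθ hα hαθ hαμ).mem_Ab H hlong
      ⟨_, Set.mem_insert _ _⟩
    rwa [Set.union_insert, Set.union_singleton, Set.insert_comm]
  have hηα : ∀ α ∈ simpleRoots b, B.form α μ = 0 →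
      w⁻¹ • (θ - α) ∉ Imin ∧ w⁻¹ • (θ - α) ≠ η := by
    intro α hα hαμ
    refine ⟨hnot _ ?_, fun he ↦ ?_⟩
    · rw [theta_form_inv_smul hw.smul, map_sub, hμθ, H.symm, hαμ, sub_zero]
    · have := MulAction.injective _ he
      rw [sub_eq_self] at this
      exact H.zero_notMem (this ▸ H.root_of_pos (H.simple_mem hα).1)
  have hI''ne : ∀ α ∈ simpleRoots b, B.form α μ = 0 →
      Imin ∪ {η, w⁻¹ • (θ - α)} ≠ Imin ∧ Imin ∪ {η, w⁻¹ • (θ - α)} ≠ Imin ∪ {η} := by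
    intro α hα hαμ
    obtain ⟨h1, h2⟩ := hηα α hα hαμ
    have hmem : w⁻¹ • (θ - α) ∈ Imin ∪ {η, w⁻¹ • (θ - α)} := by simp
    refine ⟨fun he ↦ h1 (he ▸ hmem), fun he ↦ ?_⟩
    rw [he] at hmem
    exact hmem.elim h1 h2
  have hcases := fun J (hJ : J ∈ Ab b B.form θ μ) ↦ eq_or_of_mem_Ab H hlong hμlong hw hJ
  refine ⟨⟨fun hcard ↦ ?_, ?_⟩, Imin, w, ⟨hImin_mem, hleast⟩, hwS, fun u hu ↦ ?_, ⟨⟨hI', hI'ne⟩, ?_⟩,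
    fun J ↦ ⟨fun hJ ↦ ?_, ?_⟩⟩
  · by_contra! hcon
    have hsub : Ab b B.form θ μ ⊆ {Imin, Imin ∪ {η}} := by
      intro J hJ
      rcases hcases J hJ with h1 | ⟨-, h1 | ⟨α, hα, hαθ, hαμ, -⟩⟩
      · exact Or.inl h1
      · exact Or.inr h1
      · exact absurd hαμ (hcon α hα hαθ)
    refine absurd hcard (not_lt.2 ((Set.encard_le_encard hsub).trans ?_))
    rw [Set.encard_pair hI'ne.symm]
  · rintro ⟨α, hα, hαθ, hαμ⟩
    obtain ⟨h1, h2⟩ := hI''ne α hα hαμ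
    have hsub : {Imin ∪ {η, w⁻¹ • (θ - α)}, Imin ∪ {η}, Imin} ⊆ Ab b B.form θ μ := by
      rintro J (rfl | rfl | rfl)
      exacts [hI'' α hα hαθ hαμ, hI', hImin_mem]
    refine lt_of_lt_of_le ?_ (Set.encard_le_encard hsub)
    rw [Set.encard_eq_three.2 ⟨_, _, _, h2, h1, hI'ne, rfl⟩]
    norm_num
  · have hu' := hpos u hu
    exact H.eq_of_smul_theta_eq (hu'.smul.trans hw.smul.symm) hu'.pos hw.pos
  · rintro J ⟨hJ, hJne⟩
    rcases hcases J hJ with h1 | ⟨h1, -⟩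
    · exact absurd h1 hJne
    · exact Set.union_subset (hleast J hJ) (Set.singleton_subset_iff.2 h1)
  · obtain ⟨hJA, hJne⟩ := hJ.prop
    rw [Set.mem_insert_iff, Set.mem_singleton_iff, not_or] at hJne
    rcases hcases J hJA with h1 | ⟨h1, h2 | ⟨α, hα, hαθ, hαμ, hmem⟩⟩
    · exact absurd h1 hJne.1
    · exact absurd h2 hJne.2
    · refine ⟨α, hα, hαθ, hαμ, ?_⟩
      have hsub : Imin ∪ {η, w⁻¹ • (θ - α)} ⊆ J :=
        Set.union_subset (hleast J hJA) (Set.pair_subset h1 hmem)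
      refine (hJ.le_of_le ⟨hI'' α hα hαθ hαμ, ?_⟩ hsub).antisymm hsub
      rw [Set.mem_insert_iff, Set.mem_singleton_iff, not_or]
      exact hI''ne α hα hαμ
  · rintro ⟨α, hα, hαθ, hαμ, rfl⟩
    refine ⟨⟨hI'' α hα hαθ hαμ, ?_⟩, fun K hK hKle ↦ ?_⟩
    · rw [Set.mem_insert_iff, Set.mem_singleton_iff, not_or]
      exact hI''ne α hα hαμ
    · obtain ⟨hKA, hKne⟩ := hK
      rw [Set.mem_insert_iff, Set.mem_singleton_iff, not_or] at hKne
      rcases hcases K hKA with h1 | ⟨h1, h2 | ⟨α', hα', -, hαμ', hmem⟩⟩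
      · exact absurd h1 hKne.1
      · exact absurd h2 hKne.2
      · obtain ⟨h3, h4⟩ := hηα α' hα' hαμ'
        -- Different simple roots give incomparable ideals: the new member of `K` lies neither in
        -- `Imin` nor equals `η`, so it must be the third kind of member of the larger ideal.
        have h5 : w⁻¹ • (θ - α') = w⁻¹ • (θ - α) := by
          rcases hKle hmem with h5 | h5 | h5
          exacts [absurd h5 h3, absurd h5 h4, h5]
        exact Set.union_subset (hleast K hKA) (Set.pair_subset h1 (h5 ▸ hmem))
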